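/- For $a,b\in\mathbb{Q}$, $z\in\mathbb{C}$ and $\operatorname{Im}\tau>0$ let $$\vartheta_{a,b}(z,\tau)=\sum_{n\in\mathbb{Z}}\exp\big(\pi i(n+a)^2\tau+2\pi i(n+a)(z+b)\big),\qquad q(z)=\frac{\vartheta_{1/2,1/2}(z,i)}{\vartheta_{0,0}(z,i)},$$ and let $F(\alpha,\beta,\gamma;x)=\sum_{n\ge 0}\frac{(\alpha)_n(\beta)_n}{(\gamma)_n\,n!}x^n$ $(|x|<1)$ be the Gauss hypergeometric series. For all $z$ in some neighbourhood of $0$ in $\mathbb{C}$ one has $\vartheta_{0,0}(z,i)\neq 0$, $|q(z)^4|<1$ and $$-\frac{2\sqrt{2\pi}}{\Gamma(1/4)^2}\cdot q(z)\cdot F\Big(\tfrac14,\tfrac12,\tfrac54;\,q(z)^4\Big)=z.$$ This is the explicit inversion of the Schwarz map for $(\alpha,\beta,\gamma)=(\tfrac14,0,\tfrac12)$ in the following sense. Let $U=\{x\in\mathbb{C}: \max(|x|,|1-x|)<1,\ \operatorname{Im}x>0\}$, and for $x\in U$ let $$S(x)=\frac{1}{1-i}\cdot\frac{\int_1^x t^{-1/2}(t-1)^{-3/4}\,dt}{\int_1^\infty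 t^{-1/2}(t-1)^{-3/4}\,dt},$$ where the first integral is along the segment from $1$ to $x$, with $t^{-1/2}$ principal and $\arg(t-1)=\pi+\arg(1-x)$, $\arg (1-x)\in(-\pi/2,\pi/2)$, and the second is along the real half-line with positive integrand. Then $\vartheta_{0,0}(S(x),i)\ne0$ and $1-q(S(x))^4=x$ for every $x\in U$; and for all $z$ in some neighbourhood of $0$ with $1-q(z)^4\in U$, one has $S(1-q(z)^4)=i^k z$ for some integer $k\ge 0$. -/

import Mathlib

open Complex Filter Topology

/-- The theta function with rational characteristics `a`, `b`,
`ϑ_{a,b}(z, τ) = ∑_{n ∈ ℤ} exp (π i (n + a)² τ + 2 π i (n + a) (z + b))`, for `Im τ > 0`. -/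
noncomputable def thetaChar (a b : ℚ) (z τ : ℂ) : ℂ :=
  ∑' n : ℤ, cexp (Real.pi * I * ((n : ℂ) + (a : ℂ)) ^ 2 * τ
    + 2 * Real.pi * I * ((n : ℂ) + (a : ℂ)) * (z + (b : ℂ)))

/-- The quotient `ϑ_{1/2,1/2}(z, i) / ϑ_{0,0}(z, i)`. -/
noncomputable def thetaQuot (z : ℂ) : ℂ :=
  thetaChar (1 / 2) (1 / 2) z I / thetaChar 0 0 z I

/-- The domain `{x ∈ ℂ | max (|x|, |1 - x|) < 1, Im x > 0}`. -/
def lensU : Set ℂ := {x | max ‖x‖ ‖1 - x‖ < 1 ∧ 0 < x.im}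

/-- The solution `∫_1^x t^(β-γ) (t-x)^(-β) (t-1)^(γ-α-1) dt` of the hypergeometric equation with
parameters `α, β, γ`, for `x ∈ lensU`, along the segment `t = 1 + r (x - 1)`, `0 < r < 1`. Here
`t` and `t - x` have their principal arguments and `arg (t - 1) = π + arg (1 - x)`, so that
`(t - 1) ^ s = exp (π i s) (1 - t) ^ s` with the principal power of `1 - t = r (1 - x)`. -/
noncomputable def eulerSol₁ (α β γ x : ℂ) : ℂ :=
  ∫ r in (0 : ℝ)..1,
    (1 + (r : ℂ) * (x - 1)) ^ (β - γ) * (1 + (r : ℂ) * (x - 1) - x) ^ (-β) *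
      (cexp (Real.pi * I * (γ - α - 1)) * ((r : ℂ) * (1 - x)) ^ (γ - α - 1)) * (x - 1)

/-- The solution `∫_1^∞ t^(β-γ) (t-x)^(-β) (t-1)^(γ-α-1) dt` of the hypergeometric equation with
parameters `α, β, γ`, for `x ∈ lensU`; all arguments are principal. -/
noncomputable def eulerSol₂ (α β γ x : ℂ) : ℂ :=
  ∫ t in Set.Ioi (1 : ℝ),
    (t : ℂ) ^ (β - γ) * ((t : ℂ) - x) ^ (-β) * ((t : ℂ) - 1) ^ (γ - α - 1)

/-- The (normalised) Schwarz map `f₁ / ((1 - i) f₂)` for `(α, β, γ) = (1/4, 0, 1/2)`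
on `lensU`. -/
noncomputable def schwarzMap (x : ℂ) : ℂ :=
  eulerSol₁ (1 / 4) 0 (1 / 2) x / ((1 - I) * eulerSol₂ (1 / 4) 0 (1 / 2) x)

/-! With `q = thetaQuot` and λ = `lemniscateFactor`, the point is the differential equation q' = -λ
√(1 - q⁴), q(0) = 0: up to sign and scale q is the lemniscate sine, and its inverse is G(w) = ∫_0^w
(1 - t⁴)^(-1/2) dt = w F(1/4, 1/2, 5/4; w⁴), so that G(q(z)) = -λ z near 0.

The equation comes from a dimension count. A 1-periodic entire function with multiplier K exp(-4πiz)
under z ↦ z + i is determined by two Fourier coefficients, so any three such functions are linearly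
dependent (`exists_linear_relation_of_quasiperiodic`). This gives two quadratic theta relations
whose product is 2 ϑ₂²ϑ₄² = ϑ₃⁴ - ϑ₁⁴, and the Wronskian formula ϑ₁'ϑ₃ - ϑ₁ϑ₃' = c ϑ₂ϑ₄. The simple
coefficients reflect that τ = i is fixed by τ ↦ -1/τ, which also yields q(iz) = i q(z). The constant
c is found on [0, 1/2], where -q increases from 0 to 1, so that the equation integrates to a beta
value.

The Schwarz map becomes S(x) = i λ⁻¹ G((1 - x)^(1/4)) by Euler's integrals. The local inversion
extends to the whole unit disc by the identity theorem, because ϑ₁ and ϑ₃ have no common zero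
(`thetaQuot_arcsinLemniscate`); the powers of i disappear in q⁴. -/

/-! ### Quasi-periodic entire functions and their Fourier coefficients -/

/-- The `n`-th Fourier coefficient of a `1`-periodic function, as an integral over `[0, 1]`. -/
noncomputable def unitFourierCoeff (h : ℂ → ℂ) (n : ℤ) : ℂ :=
  ∫ x in (0 : ℝ)..1, cexp (-(2 * Real.pi * I * n * x)) * h x

/-- Cauchy's theorem on the rectangle with vertices 0, 1, 1 + i, i: the vertical sides cancel by
periodicity, and on the top side the multiplier exp(-4πiz) moves the frequency by 2. -/
theorem unitFourierCoeff_shift {h : ℂ → ℂ} (hd : Differentiable ℂ h) (h1 : ∀ z, h (z + 1) = h z)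
    {K : ℂ} (hI : ∀ z, h (z + I) = K * cexp (-(4 * Real.pi * I * z)) * h z) (n : ℤ) :
    unitFourierCoeff h n = K * cexp (2 * Real.pi * n) * unitFourierCoeff h (n + 2) := by
  have hE : Differentiable ℂ fun z : ℂ => cexp (-(2 * Real.pi * I * n * z)) * h z := by fun_prop
  have H := integral_boundary_rect_eq_zero_of_differentiableOn
    (fun z : ℂ => cexp (-(2 * Real.pi * I * n * z)) * h z) 0 (1 + I) hE.differentiableOn
  have hper : ∀ y : ℝ, cexp (-(2 * Real.pi * I * n * (1 + y * I))) * h (1 + y * I) =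
      cexp (-(2 * Real.pi * I * n * (y * I))) * h (y * I) := by
    intro y
    rw [add_comm (1 : ℂ), h1]
    congr 1
    rw [Complex.exp_eq_exp_iff_exists_int]
    exact ⟨-n, by push_cast; ring⟩
  have hsh : ∀ x : ℝ, cexp (-(2 * Real.pi * I * n * (x + I))) * h (x + I) =
      K * cexp (2 * Real.pi * n) * (cexp (-(2 * Real.pi * I * (n + 2 : ℤ) * x)) * h x) := by
    intro x
    rw [hI]
    have : cexp (-(2 * Real.pi * I * n * (x + I))) * cexp (-(4 * Real.pi * I * x)) =
        cexp (2 * Real.pi * n) * cexp (-(2 * Real.pi * I * (n + 2 : ℤ) * x)) := by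
      rw [← Complex.exp_add, ← Complex.exp_add]
      congr 1
      push_cast
      linear_combination (-2 * Real.pi * n : ℂ) * I_sq
    linear_combination K * h x * this
  simp only [zero_re, zero_im, add_re, one_re, I_re, add_zero, add_im, one_im, I_im, zero_add,
    ofReal_zero, zero_mul, ofReal_one, one_mul, hper, add_sub_cancel_right, hsh,
    intervalIntegral.integral_const_mul] at H
  rw [unitFourierCoeff, unitFourierCoeff]
  rw [sub_eq_zero] at H
  exact H

/-- The coefficients are trivially summable, so the Fourier series converges to `h` on the real
line; the identity theorem does the rest. -/
theorem eq_zero_of_unitFourierCoeff_eq_zero {h : ℂ → ℂ} (hd : Differentiable ℂ h)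
    (h1 : ∀ z, h (z + 1) = h z) (h0 : ∀ n, unitFourierCoeff h n = 0) (z : ℂ) : h z = 0 := by
  have : Fact ((0 : ℝ) < 1) := ⟨one_pos⟩
  have hper : Function.Periodic (fun x : ℝ => h x) 1 := fun x => by
    simpa using h1 x
  have hcont : Continuous fun x : ℝ => h x := hd.continuous.comp continuous_ofReal
  let f : C(AddCircle (1 : ℝ), ℂ) :=
    ⟨hper.lift, continuous_quot_lift _ hcont⟩
  have hf : ∀ n, fourierCoeff f n = 0 := by
    intro n
    rw [fourierCoeff_eq_intervalIntegral _ _ 0, zero_add, div_one, one_smul, ← h0 n,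
      unitFourierCoeff]
    refine intervalIntegral.integral_congr fun x _ => ?_
    change fourier (-n) (x : AddCircle (1 : ℝ)) • h x = _
    rw [fourier_coe_apply, smul_eq_mul]
    congr 2
    push_cast
    ring
  have hf0 : fourierCoeff f = 0 := funext hf
  have hreal : ∀ x : ℝ, h x = 0 := by
    intro x
    have := has_pointwise_sum_fourier_series_of_summable (f := f) (by rw [hf0]; exact summable_zero)
      (x : AddCircle (1 : ℝ))
    simp only [hf, zero_smul] at this
    exact this.unique hasSum_zero
  have hfreq : ∃ᶠ w in 𝓝[≠] (0 : ℂ), h w = 0 := by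
    have ht : Tendsto (fun n : ℕ => ((1 / ((n : ℝ) + 1) : ℝ) : ℂ)) atTop (𝓝[≠] 0) := by
      refine tendsto_nhdsWithin_iff.2 ⟨?_, Eventually.of_forall fun n => ?_⟩
      · exact (continuous_ofReal.tendsto' 0 0 ofReal_zero).comp
          tendsto_one_div_add_atTop_nhds_zero_nat
      · simp only [Set.mem_compl_iff, Set.mem_singleton_iff, ofReal_eq_zero]
        positivity
    exact ht.frequently (Eventually.of_forall fun n => hreal _).frequently
  exact (hd.differentiableOn.analyticOnNhd isOpen_univ).eqOn_zero_of_preconnected_of_frequently_eq_zero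
    isPreconnected_univ (Set.mem_univ _) hfreq (Set.mem_univ z)

theorem eq_zero_of_quasiperiodic {h : ℂ → ℂ} (hd : Differentiable ℂ h)
    (h1 : ∀ z, h (z + 1) = h z) {K : ℂ} (hK : K ≠ 0)
    (hI : ∀ z, h (z + I) = K * cexp (-(4 * Real.pi * I * z)) * h z)
    (h0 : unitFourierCoeff h 0 = 0) (h1' : unitFourierCoeff h 1 = 0) (z : ℂ) : h z = 0 := by
  refine eq_zero_of_unitFourierCoeff_eq_zero hd h1 (fun n => ?_) z
  have key : ∀ n : ℤ, unitFourierCoeff h n = 0 ↔ unitFourierCoeff h (n + 2) = 0 := fun n => by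
    rw [unitFourierCoeff_shift hd h1 hI n]
    simp [hK, Complex.exp_ne_zero]
  have : ∀ n : ℤ, unitFourierCoeff h n = 0 ∧ unitFourierCoeff h (n + 1) = 0 := by
    intro n
    induction n using Int.induction_on with
    | zero => exact ⟨h0, by simpa using h1'⟩
    | succ i ih => exact ⟨ih.2, by rw [add_assoc]; exact (key _).1 ih.1⟩
    | pred i ih =>
      have e := key (-(i : ℤ) - 1)
      rw [show -(i : ℤ) - 1 + 2 = -i + 1 by ring] at e
      exact ⟨e.2 ih.2, by simpa using ih.1⟩
  exact (this n).1

/-- The space of entire functions with `h (z + 1) = h z`, `h (z + i) = K exp (-4 π i z) h z` has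
dimension at most `2`. -/
theorem exists_linear_relation_of_quasiperiodic {f : Fin 3 → ℂ → ℂ}
    (hd : ∀ j, Differentiable ℂ (f j)) (h1 : ∀ j z, f j (z + 1) = f j z) {K : ℂ} (hK : K ≠ 0)
    (hI : ∀ j z, f j (z + I) = K * cexp (-(4 * Real.pi * I * z)) * f j z) :
    ∃ c : Fin 3 → ℂ, c ≠ 0 ∧ ∀ z, c 0 * f 0 z + c 1 * f 1 z + c 2 * f 2 z = 0 := by
  -- The zero third row makes the matrix singular; a kernel vector gives a combination whose
  -- coefficients of index 0 and 1 both vanish.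
  let A : Matrix (Fin 3) (Fin 3) ℂ := Matrix.of ![
    fun j => unitFourierCoeff (f j) 0, fun j => unitFourierCoeff (f j) 1, 0]
  have hA : A.det = 0 := Matrix.det_eq_zero_of_row_eq_zero (2 : Fin 3) fun j => rfl
  obtain ⟨c, hc, hc0⟩ := Matrix.exists_mulVec_eq_zero_iff.2 hA
  have hlin : ∀ n, unitFourierCoeff (fun z => c 0 * f 0 z + c 1 * f 1 z + c 2 * f 2 z) n =
      ∑ j, unitFourierCoeff (f j) n * c j := by
    intro n
    have hint : ∀ j, IntervalIntegrable
        (fun x : ℝ => c j * (cexp (-(2 * Real.pi * I * n * x)) * f j x))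
        MeasureTheory.volume 0 1 := fun j => by
      have := (hd j).continuous
      exact Continuous.intervalIntegrable (by fun_prop) _ _
    rw [Fin.sum_univ_three]
    simp only [unitFourierCoeff, mul_comm _ (c _), ← intervalIntegral.integral_const_mul]
    rw [← intervalIntegral.integral_add (hint 0) (hint 1),
      ← intervalIntegral.integral_add ((hint 0).add (hint 1)) (hint 2)]
    congr 1
    ext x
    ring
  refine ⟨c, hc, eq_zero_of_quasiperiodic (by have := hd; fun_prop) (fun z => by simp only [h1]) hK
    (fun z => by simp only [hI]; ring) ?_ ?_⟩
  · rw [hlin]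
    exact congrFun hc0 0
  · rw [hlin]
    exact congrFun hc0 1

/-! ### Theta functions at τ = i: periods, parity, special values -/

/-- The function `ϑ_{0,0}(z, i)`. -/
noncomputable def thetaThree (z : ℂ) : ℂ := jacobiTheta₂ z I

/-- The function `ϑ_{1/2,0}(z, i)`. -/
noncomputable def thetaTwo (z : ℂ) : ℂ :=
  cexp (-(Real.pi / 4) + Real.pi * I * z) * thetaThree (z + I / 2)

theorem thetaChar_zero_zero (z : ℂ) : thetaChar 0 0 z I = thetaThree z := by
  unfold thetaChar thetaThree jacobiTheta₂ jacobiTheta₂_term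
  refine tsum_congr fun n => ?_
  congr 1
  push_cast
  ring

theorem thetaChar_half_half (z : ℂ) : thetaChar (1 / 2) (1 / 2) z I = thetaTwo (z + 1 / 2) := by
  unfold thetaChar thetaTwo thetaThree jacobiTheta₂ jacobiTheta₂_term
  rw [← tsum_mul_left]
  refine tsum_congr fun n => ?_
  rw [← Complex.exp_add]
  congr 1
  push_cast
  linear_combination (Real.pi / 4 : ℂ) * I_sq

theorem differentiable_thetaThree : Differentiable ℂ thetaThree := fun z =>
  differentiableAt_jacobiTheta₂_fst z (by simp)

theorem differentiable_thetaTwo : Differentiable ℂ thetaTwo := by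
  unfold thetaTwo
  have := differentiable_thetaThree
  fun_prop

theorem thetaThree_add_one (z : ℂ) : thetaThree (z + 1) = thetaThree z :=
  jacobiTheta₂_add_left z I

theorem thetaThree_add_I (z : ℂ) :
    thetaThree (z + I) = cexp (Real.pi - 2 * Real.pi * I * z) * thetaThree z := by
  unfold thetaThree
  rw [jacobiTheta₂_add_left']
  congr 2
  linear_combination (-Real.pi : ℂ) * I_sq

theorem thetaThree_neg (z : ℂ) : thetaThree (-z) = thetaThree z := jacobiTheta₂_neg_left z I

/-- The Jacobi functional equation for τ ↦ -1/τ, which fixes τ = i. -/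
theorem thetaThree_I_mul (z : ℂ) :
    thetaThree (I * z) = cexp (Real.pi * z ^ 2) * thetaThree z := by
  have h := jacobiTheta₂_functional_equation (I * z) I
  rw [mul_div_cancel_left₀ _ I_ne_zero] at h
  have e1 : -I * I = 1 := by simp
  have e2 : -1 / I = I := by simp
  rw [e1, e2, Complex.one_cpow, one_div_one, one_mul] at h
  rw [thetaThree, h, thetaThree]
  congr 2
  rw [mul_pow, I_sq, div_eq_mul_inv, inv_I]
  linear_combination (-Real.pi * z ^ 2 : ℂ) * I_sq

theorem thetaTwo_add_one (z : ℂ) : thetaTwo (z + 1) = -thetaTwo z := by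
  unfold thetaTwo
  rw [add_right_comm, thetaThree_add_one, mul_add, ← add_assoc, Complex.exp_add, mul_one,
    exp_pi_mul_I]
  ring

theorem thetaTwo_add_I (z : ℂ) :
    thetaTwo (z + I) = cexp (Real.pi - 2 * Real.pi * I * z) * thetaTwo z := by
  unfold thetaTwo
  rw [add_right_comm, thetaThree_add_I, ← mul_assoc, ← mul_assoc, ← Complex.exp_add,
    ← Complex.exp_add]
  congr 2
  ring

theorem thetaTwo_neg (z : ℂ) : thetaTwo (-z) = thetaTwo z := by
  unfold thetaTwo
  have h := thetaThree_add_I (z - I / 2)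
  rw [show z - I / 2 + I = z + I / 2 by ring] at h
  rw [h, show -z + I / 2 = -(z - I / 2) by ring, thetaThree_neg, ← mul_assoc, ← Complex.exp_add]
  congr 2
  linear_combination (-Real.pi : ℂ) * I_sq

theorem thetaTwo_half : thetaTwo (1 / 2) = 0 := by
  have h := thetaTwo_add_one (-(1 / 2))
  rw [thetaTwo_neg, show -(1 / 2 : ℂ) + 1 = 1 / 2 by norm_num] at h
  exact self_eq_neg.1 h

theorem thetaThree_I_half : thetaThree (I / 2) = cexp (Real.pi / 4) * thetaThree (1 / 2) := by
  rw [show I / 2 = I * (1 / 2) by ring, thetaThree_I_mul]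
  congr 2
  ring

theorem thetaTwo_zero : thetaTwo 0 = thetaThree (1 / 2) := by
  rw [thetaTwo, zero_add, thetaThree_I_half, ← mul_assoc, ← Complex.exp_add]
  simp

theorem thetaThree_half_add_I_half : thetaThree (1 / 2 + I / 2) = 0 := by
  have h := thetaTwo_half
  rw [thetaTwo] at h
  exact (mul_eq_zero.1 h).resolve_left (Complex.exp_ne_zero _)

theorem thetaTwo_half_add_I_half_sq :
    thetaTwo (1 / 2 + I / 2) ^ 2 = -cexp (Real.pi / 2) * thetaThree (1 / 2) ^ 2 := by
  have hE : (-1 : ℂ) = cexp (-(Real.pi * I)) := by rw [Complex.exp_neg, exp_pi_mul_I]; norm_num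
  rw [thetaTwo, add_assoc, add_halves, thetaThree_add_I, ← mul_assoc, ← Complex.exp_add, mul_pow,
    ← Complex.exp_nat_mul, ← neg_one_mul (cexp (Real.pi / 2)), hE, ← Complex.exp_add]
  congr 2
  push_cast
  linear_combination (Real.pi : ℂ) * I_sq

/-- The argument of ϑ₃ on the left is i (z + 1/2 - i/2); after `thetaThree_I_mul`, a shift by i
leads back to z + 1/2 + i/2. -/
theorem thetaTwo_I_mul_add_half (z : ℂ) :
    thetaTwo (I * z + 1 / 2) = I * cexp (Real.pi * z ^ 2) * thetaTwo (z + 1 / 2) := by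
  have h1 : thetaThree (I * z + 1 / 2 + I / 2) =
      cexp (Real.pi * (z + 1 / 2 - I / 2) ^ 2) * thetaThree (z + 1 / 2 - I / 2) := by
    rw [← thetaThree_I_mul]
    congr 1
    linear_combination (1 / 2 : ℂ) * I_sq
  have h2 := thetaThree_add_I (z + 1 / 2 - I / 2)
  rw [show z + 1 / 2 - I / 2 + I = z + 1 / 2 + I / 2 by ring] at h2
  have hE : cexp (Real.pi / 2 * I) = I := by rw [exp_mul_I]; simp
  rw [thetaTwo, thetaTwo, h1, h2, show I * cexp (Real.pi * z ^ 2) =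
    cexp (Real.pi / 2 * I) * cexp (Real.pi * z ^ 2) by rw [hE]]
  simp only [← mul_assoc, ← Complex.exp_add]
  congr 2
  linear_combination (Real.pi * z - 3 * Real.pi / 4 : ℂ) * I_sq

/-- The function `ϑ_{1/2,1/2}(z, i)`. -/
noncomputable def thetaOne (z : ℂ) : ℂ := thetaTwo (z + 1 / 2)

/-- The function `ϑ_{0,1/2}(z, i)`. -/
noncomputable def thetaFour (z : ℂ) : ℂ := thetaThree (z + 1 / 2)

/-- On the imaginary axis every term of the series is positive; `thetaThree_I_mul` carries this to
the real axis, where the terms have varying signs. -/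
theorem thetaThree_ofReal_pos (x : ℝ) : ∃ r : ℝ, 0 < r ∧ thetaThree x = r := by
  have h : HasSum (fun n : ℤ => ((Real.exp (-(2 * Real.pi * n * x) - Real.pi * n ^ 2) : ℝ) : ℂ))
      (thetaThree (I * x)) := by
    have h0 := hasSum_jacobiTheta₂_term (I * x) (τ := I) (by simp)
    refine h0.congr_fun ?_
    intro n
    rw [jacobiTheta₂_term, ofReal_exp]
    congr 1
    push_cast
    linear_combination (-2 * Real.pi * n * x - Real.pi * n ^ 2 : ℂ) * I_sq
  have hs : Summable fun n : ℤ => Real.exp (-(2 * Real.pi * n * x) - Real.pi * n ^ 2) := by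
    exact_mod_cast h.summable
  have hT := h.unique (hasSum_ofReal.2 hs.hasSum)
  rw [thetaThree_I_mul] at hT
  refine ⟨Real.exp (-(Real.pi * x ^ 2)) *
    ∑' n : ℤ, Real.exp (-(2 * Real.pi * n * x) - Real.pi * n ^ 2), ?_, ?_⟩
  · exact mul_pos (Real.exp_pos _) (hs.tsum_pos (fun n => (Real.exp_pos _).le) 0 (Real.exp_pos _))
  · rw [ofReal_mul, ← hT, ← mul_assoc, ofReal_exp, ← Complex.exp_add]
    push_cast
    simp

theorem thetaThree_ofReal_ne_zero (x : ℝ) : thetaThree x ≠ 0 := by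
  obtain ⟨r, hr, h⟩ := thetaThree_ofReal_pos x
  rw [h]
  exact_mod_cast hr.ne'

theorem thetaThree_zero_ne_zero : thetaThree 0 ≠ 0 := by
  simpa using thetaThree_ofReal_ne_zero 0

theorem thetaThree_half_ne_zero : thetaThree (1 / 2) ≠ 0 := by
  simpa using thetaThree_ofReal_ne_zero (1 / 2)

theorem differentiable_thetaOne : Differentiable ℂ thetaOne := by
  unfold thetaOne
  have := differentiable_thetaTwo
  fun_prop

theorem differentiable_thetaFour : Differentiable ℂ thetaFour := by
  unfold thetaFour
  have := differentiable_thetaThree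
  fun_prop

theorem thetaOne_add_one (z : ℂ) : thetaOne (z + 1) = -thetaOne z := by
  rw [thetaOne, add_right_comm, thetaTwo_add_one, thetaOne]

theorem thetaFour_add_one (z : ℂ) : thetaFour (z + 1) = thetaFour z := by
  rw [thetaFour, add_right_comm, thetaThree_add_one, thetaFour]

theorem exp_multiplier_add_half (z : ℂ) : cexp (Real.pi - 2 * Real.pi * I * (z + 1 / 2)) =
    -cexp (Real.pi - 2 * Real.pi * I * z) := by
  rw [show Real.pi - 2 * Real.pi * I * (z + 1 / 2) =
    Real.pi - 2 * Real.pi * I * z - Real.pi * I by ring, Complex.exp_sub _ (Real.pi * I),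
    exp_pi_mul_I]
  ring

theorem thetaOne_add_I (z : ℂ) :
    thetaOne (z + I) = -cexp (Real.pi - 2 * Real.pi * I * z) * thetaOne z := by
  rw [thetaOne, add_right_comm, thetaTwo_add_I, exp_multiplier_add_half, thetaOne]

theorem thetaFour_add_I (z : ℂ) :
    thetaFour (z + I) = -cexp (Real.pi - 2 * Real.pi * I * z) * thetaFour z := by
  rw [thetaFour, add_right_comm, thetaThree_add_I, exp_multiplier_add_half, thetaFour]

theorem thetaOne_neg (z : ℂ) : thetaOne (-z) = -thetaOne z := by
  rw [thetaOne, thetaOne, ← thetaTwo_neg, show -(-z + 1 / 2) = z - 1 / 2 by ring,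
    ← neg_eq_iff_eq_neg, ← thetaTwo_add_one]
  congr 1
  ring

theorem thetaFour_neg (z : ℂ) : thetaFour (-z) = thetaFour z := by
  rw [thetaFour, thetaFour, ← thetaThree_neg, show -(-z + 1 / 2) = z - 1 / 2 by ring,
    ← thetaThree_add_one]
  congr 1
  ring

theorem thetaOne_zero : thetaOne 0 = 0 := by rw [thetaOne, zero_add, thetaTwo_half]

theorem thetaFour_zero : thetaFour 0 = thetaThree (1 / 2) := by rw [thetaFour, zero_add]

theorem thetaOne_half : thetaOne (1 / 2) = -thetaThree (1 / 2) := by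
  rw [thetaOne, add_halves, ← thetaTwo_zero]
  simpa using thetaTwo_add_one 0

theorem thetaFour_half : thetaFour (1 / 2) = thetaThree 0 := by
  rw [thetaFour, add_halves]
  simpa using thetaThree_add_one 0

theorem multiplier_sq (z : ℂ) : cexp (Real.pi - 2 * Real.pi * I * z) ^ 2 =
    cexp (2 * Real.pi) * cexp (-(4 * Real.pi * I * z)) := by
  rw [← Complex.exp_nat_mul, ← Complex.exp_add]
  congr 1
  push_cast
  ring

theorem thetaOne_half_add_I_half_sq_ne_zero : thetaOne (1 / 2 + I / 2) ^ 2 ≠ 0 := by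
  have h : thetaOne (1 / 2 + I / 2) = -(cexp (-(Real.pi / 4) + Real.pi * I * (I / 2)) *
      (cexp (Real.pi - 2 * Real.pi * I * 0) * thetaThree 0)) := by
    rw [thetaOne, show 1 / 2 + I / 2 + 1 / 2 = I / 2 + 1 by ring, thetaTwo_add_one, thetaTwo,
      add_halves, ← thetaThree_add_I, zero_add]
  rw [h]
  simp [Complex.exp_ne_zero, thetaThree_zero_ne_zero]

/-! ### Theta relations and the Wronskian -/

/-- At a common zero a, the relation between ϑ₃(z)², ϑ₁(z)² and ϑ₃(a + z)ϑ₃(a - z) loses its first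
two coefficients at z = 0 and z = 1/2 + i/2, so the last product would vanish identically. No count
of zeros is needed. -/
theorem thetaOne_thetaThree_no_common_zero {a : ℂ} (h1 : thetaOne a = 0) : thetaThree a ≠ 0 := by
  intro h3
  have d1 := differentiable_thetaOne
  have d3 := differentiable_thetaThree
  obtain ⟨c, hc, hrel⟩ := exists_linear_relation_of_quasiperiodic
    (f := ![fun z => thetaThree z ^ 2, fun z => thetaOne z ^ 2,
      fun z => thetaThree (a + z) * thetaThree (a - z)]) (K := cexp (2 * Real.pi))
    (by intro j; fin_cases j <;> simp <;> fun_prop)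
    (by
      intro j z
      fin_cases j
      · simp [thetaThree_add_one]
      · simp [thetaOne_add_one]
      · have := thetaThree_add_one (a - (z + 1))
        rw [show a - (z + 1) + 1 = a - z by ring] at this
        simp [← add_assoc, thetaThree_add_one, this])
    (Complex.exp_ne_zero _)
    (by
      intro j z
      rw [← multiplier_sq]
      fin_cases j
      · simp [thetaThree_add_I, mul_pow]
      · simp [thetaOne_add_I, mul_pow]
      · have h := thetaThree_add_I (a - (z + I))
        rw [show a - (z + I) + I = a - z by ring] at h
        simp only [Fin.reduceFinMk, Matrix.cons_val]
        rw [← add_assoc, thetaThree_add_I, h, ← Complex.exp_nat_mul]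
        have e : cexp (Real.pi - 2 * Real.pi * I * (a + z)) =
            cexp ((2 : ℕ) * (Real.pi - 2 * Real.pi * I * z)) *
              cexp (Real.pi - 2 * Real.pi * I * (a - (z + I))) := by
          rw [← Complex.exp_add]
          congr 1
          push_cast
          linear_combination (-2 * Real.pi : ℂ) * I_sq
        rw [e]
        ring)
  simp only [Matrix.cons_val_zero, Matrix.cons_val_one, Matrix.cons_val] at hrel
  have hc0 : c 0 = 0 := by
    have := hrel 0
    simpa [thetaOne_zero, h3, thetaThree_zero_ne_zero] using this
  have hc1 : c 1 = 0 := by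
    have := hrel (1 / 2 + I / 2)
    have h : thetaThree (a + (1 / 2 + I / 2)) = 0 := by
      rw [thetaOne, thetaTwo, add_assoc] at h1
      exact (mul_eq_zero.1 h1).resolve_left (Complex.exp_ne_zero _)
    rw [h, thetaThree_half_add_I_half] at this
    simpa only [zero_pow two_ne_zero, mul_zero, zero_mul, zero_add, add_zero, mul_eq_zero,
      thetaOne_half_add_I_half_sq_ne_zero, or_false] using this
  have hc2 : c 2 ≠ 0 := fun h => hc (by ext j; fin_cases j <;> simp [hc0, hc1, h])
  have hz : ∀ z, thetaThree (a + z) = 0 ∨ thetaThree (a - z) = 0 := fun z => by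
    simpa [hc0, hc1, hc2] using hrel z
  have hA : AnalyticOnNhd ℂ (fun z => thetaThree (a + z)) Set.univ :=
    DifferentiableOn.analyticOnNhd (by fun_prop) isOpen_univ
  have hB : AnalyticOnNhd ℂ (fun z => thetaThree (a - z)) Set.univ :=
    DifferentiableOn.analyticOnNhd (by fun_prop) isOpen_univ
  rcases hA.eq_zero_or_eq_zero_of_mul_eq_zero hB (fun z _ => mul_eq_zero.2 (hz z))
    isPreconnected_univ with h | h
  · exact thetaThree_zero_ne_zero (by simpa using h (-a) trivial)
  · exact thetaThree_zero_ne_zero (by simpa using h a trivial)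

/-- The three squares are dependent. Evaluation at i/2 makes the coefficients of ϑ₃² and ϑ₁² equal;
evaluation at 0 and 1/2 then forces ϑ₃(0)⁴ = 2 ϑ₃(1/2)⁴, and positivity selects the square root. -/
theorem sqrt_two_mul_thetaFour_sq_and :
    thetaThree 0 ^ 2 = (√2 : ℝ) * thetaThree (1 / 2) ^ 2 ∧
    ∀ z, (√2 : ℝ) * thetaFour z ^ 2 = thetaThree z ^ 2 + thetaOne z ^ 2 := by
  have d1 := differentiable_thetaOne
  have d3 := differentiable_thetaThree
  have d4 := differentiable_thetaFour
  obtain ⟨c, hc, hrel⟩ := exists_linear_relation_of_quasiperiodic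
    (f := ![fun z => thetaThree z ^ 2, fun z => thetaOne z ^ 2,
      fun z => thetaFour z ^ 2]) (K := cexp (2 * Real.pi))
    (by intro j; fin_cases j <;> simp <;> fun_prop)
    (by
      intro j z
      fin_cases j
      · simp [thetaThree_add_one]
      · simp [thetaOne_add_one]
      · simp [thetaFour_add_one])
    (Complex.exp_ne_zero _)
    (by
      intro j z
      rw [← multiplier_sq]
      fin_cases j
      · simp [thetaThree_add_I, mul_pow]
      · simp [thetaOne_add_I, mul_pow]
      · simp [thetaFour_add_I, mul_pow])
  simp only [Matrix.cons_val_zero, Matrix.cons_val_one, Matrix.cons_val] at hrel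
  obtain ⟨t, ht, hT⟩ := thetaThree_ofReal_pos 0
  obtain ⟨m, hm, hM⟩ := thetaThree_ofReal_pos (1 / 2)
  rw [ofReal_zero] at hT
  rw [show ((1 / 2 : ℝ) : ℂ) = 1 / 2 by norm_num] at hM
  have hm' : (m : ℂ) ≠ 0 := by exact_mod_cast hm.ne'
  have e1 := hrel 0
  have e2 := hrel (1 / 2)
  have e3 := hrel (I / 2)
  rw [thetaOne_zero, thetaFour_zero, hT, hM] at e1
  rw [thetaOne_half, thetaFour_half, hT, hM] at e2
  rw [thetaFour, add_comm (I / 2), thetaThree_half_add_I_half, thetaOne, add_comm (I / 2),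
    thetaTwo_half_add_I_half_sq, thetaThree_I_half, hM, mul_pow, ← Complex.exp_nat_mul,
    show ((2 : ℕ) : ℂ) * (Real.pi / 4) = Real.pi / 2 by push_cast; ring] at e3
  have e4 : c 0 = c 1 := by
    have : cexp (Real.pi / 2) * (m : ℂ) ^ 2 * (c 0 - c 1) = 0 := by linear_combination e3
    simpa [Complex.exp_ne_zero, hm', sub_eq_zero] using this
  have hc0 : c 0 ≠ 0 := by
    intro h
    rw [h] at e1 e4
    refine hc (funext fun j => ?_)
    have : c 2 = 0 := by simpa [hm'] using e1
    fin_cases j <;> simp [h, ← e4, this]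
  have e5 : (t : ℂ) ^ 4 = 2 * m ^ 4 := by
    have h : c 0 * ((t : ℂ) ^ 4 - 2 * m ^ 4) = 0 := by
      linear_combination (t : ℂ) ^ 2 * e1 - (m : ℂ) ^ 2 * e2 - (m : ℂ) ^ 4 * e4
    exact sub_eq_zero.1 ((mul_eq_zero.1 h).resolve_left hc0)
  have e6 : t ^ 2 = √2 * m ^ 2 := by
    have h : (t ^ 2) ^ 2 = (√2 * m ^ 2) ^ 2 := by
      rw [mul_pow, Real.sq_sqrt zero_le_two]
      have : t ^ 4 = 2 * m ^ 4 := by exact_mod_cast e5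
      linear_combination this
    exact (pow_left_inj₀ (by positivity) (by positivity) two_ne_zero).1 h
  have e6' : (t : ℂ) ^ 2 = (√2 : ℝ) * m ^ 2 := by exact_mod_cast e6
  refine ⟨by rw [hT, hM, e6'], fun z => ?_⟩
  have e7 : c 2 = -(c 0 * (√2 : ℝ)) := by
    have h : (m : ℂ) ^ 2 * (c 2 + c 0 * (√2 : ℝ)) = 0 := by linear_combination e1 - c 0 * e6'
    simpa [hm', add_eq_zero_iff_eq_neg] using h
  have h : c 0 * ((√2 : ℝ) * thetaFour z ^ 2 - (thetaThree z ^ 2 + thetaOne z ^ 2)) = 0 := by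
    have := hrel z
    rw [e7, ← e4] at this
    linear_combination -this
  exact sub_eq_zero.1 ((mul_eq_zero.1 h).resolve_left hc0)

theorem sqrt_two_mul_thetaFour_sq (z : ℂ) :
    (√2 : ℝ) * thetaFour z ^ 2 = thetaThree z ^ 2 + thetaOne z ^ 2 :=
  sqrt_two_mul_thetaFour_sq_and.2 z

/-- The relation for ϑ₄², combined with its translate by 1/2. -/
theorem sqrt_two_mul_thetaTwo_sq (z : ℂ) :
    (√2 : ℝ) * thetaTwo z ^ 2 = thetaThree z ^ 2 - thetaOne z ^ 2 := by
  have h := sqrt_two_mul_thetaFour_sq (z + 1 / 2)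
  have e1 : thetaOne (z + 1 / 2) = -thetaTwo z := by
    rw [thetaOne, add_assoc, add_halves, thetaTwo_add_one]
  have e4 : thetaFour (z + 1 / 2) = thetaThree z := by
    rw [thetaFour, add_assoc, add_halves, thetaThree_add_one]
  rw [e1, e4, ← thetaFour] at h
  have h2 : ((√2 : ℝ) : ℂ) ^ 2 = 2 := by
    rw [← ofReal_pow, Real.sq_sqrt zero_le_two]
    norm_num
  linear_combination -((√2 : ℝ) : ℂ) * h - sqrt_two_mul_thetaFour_sq z + thetaThree z ^ 2 * h2

theorem exists_wronskian_eq : ∃ c : ℂ, ∀ z,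
    deriv thetaOne z * thetaThree z - thetaOne z * deriv thetaThree z =
      c * (thetaFour z * thetaTwo z) := by
  have d1 := differentiable_thetaOne
  have d2 := differentiable_thetaTwo
  have d3 := differentiable_thetaThree
  have d4 := differentiable_thetaFour
  have d1' : Differentiable ℂ (deriv thetaOne) :=
    (d1.contDiff (n := 2)).differentiable_deriv_two
  have d3' : Differentiable ℂ (deriv thetaThree) :=
    (d3.contDiff (n := 2)).differentiable_deriv_two
  have hexp : ∀ z, HasDerivAt (fun z : ℂ => cexp (Real.pi - 2 * Real.pi * I * z))
      (cexp (Real.pi - 2 * Real.pi * I * z) * -(2 * Real.pi * I)) z := fun z => by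
    have h := (((hasDerivAt_id z).const_mul (2 * Real.pi * I : ℂ)).const_sub (Real.pi : ℂ)).cexp
    simpa using h
  have q1 : ∀ z, deriv thetaOne (z + 1) = -deriv thetaOne z := fun z => by
    rw [← deriv_comp_add_const, ← deriv.fun_neg]
    exact congrArg (deriv · z) (funext thetaOne_add_one)
  have q3 : ∀ z, deriv thetaThree (z + 1) = deriv thetaThree z := fun z => by
    rw [← deriv_comp_add_const]
    exact congrArg (deriv · z) (funext thetaThree_add_one)
  have n1 : ∀ z, deriv thetaOne (-z) = deriv thetaOne z := fun z => by
    have h := congrArg (deriv · z) (funext thetaOne_neg)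
    simp only [deriv_comp_neg, deriv.fun_neg] at h
    exact neg_injective h
  have n3 : ∀ z, deriv thetaThree (-z) = -deriv thetaThree z := fun z => by
    have h := congrArg (deriv · z) (funext thetaThree_neg)
    simp only [deriv_comp_neg] at h
    exact neg_eq_iff_eq_neg.1 h
  have i1 : ∀ z, deriv thetaOne (z + I) = cexp (Real.pi - 2 * Real.pi * I * z) *
      (2 * Real.pi * I * thetaOne z - deriv thetaOne z) := fun z => by
    rw [← deriv_comp_add_const, funext thetaOne_add_I,
      ((hexp z).fun_neg.fun_mul (d1 z).hasDerivAt).deriv]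
    ring
  have i3 : ∀ z, deriv thetaThree (z + I) = cexp (Real.pi - 2 * Real.pi * I * z) *
      (deriv thetaThree z - 2 * Real.pi * I * thetaThree z) := fun z => by
    rw [← deriv_comp_add_const, funext thetaThree_add_I,
      ((hexp z).fun_mul (d3 z).hasDerivAt).deriv]
    ring
  have e1 : ∀ z, cexp (Real.pi * I * (z + 1)) = -cexp (Real.pi * I * z) := fun z => by
    rw [mul_add, Complex.exp_add, mul_one, exp_pi_mul_I]
    ring
  have eI : ∀ z, cexp (Real.pi * I * (z + I)) = cexp (-Real.pi) * cexp (Real.pi * I * z) :=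
    fun z => by
      rw [← Complex.exp_add]
      congr 1
      linear_combination (Real.pi : ℂ) * I_sq
  have hK : ∀ z, -cexp Real.pi * cexp (-(4 * Real.pi * I * z)) =
      -(cexp (-Real.pi) * cexp (Real.pi - 2 * Real.pi * I * z) ^ 2) := fun z => by
    have h : cexp Real.pi = cexp (-Real.pi) * cexp (2 * Real.pi) := by
      rw [← Complex.exp_add]
      congr 1
      ring
    rw [multiplier_sq, h]
    ring
  have t2 : ∀ z, thetaFour (-z) * thetaTwo (-z) = thetaFour z * thetaTwo z := fun z => by
    rw [thetaFour_neg, thetaTwo_neg]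
  -- The factor exp(πiz) turns the common antiperiodicity into periodicity. The third function ϑ₁ϑ₃
  -- is odd while the other two, without that factor, are even, so parity at ±1/2 removes it.
  obtain ⟨c, hc, hrel⟩ := exists_linear_relation_of_quasiperiodic
    (f := ![fun z => cexp (Real.pi * I * z) *
        (deriv thetaOne z * thetaThree z - thetaOne z * deriv thetaThree z),
      fun z => cexp (Real.pi * I * z) * (thetaFour z * thetaTwo z),
      fun z => cexp (Real.pi * I * z) * (thetaOne z * thetaThree z)])
    (K := -cexp Real.pi)
    (by intro j; fin_cases j <;> simp <;> fun_prop)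
    (by
      intro j z
      fin_cases j
      · simp only [Fin.zero_eta, Matrix.cons_val_zero, q1, q3, thetaOne_add_one,
          thetaThree_add_one, e1]
        ring
      · simp only [Fin.mk_one, Matrix.cons_val_one, Matrix.cons_val_zero, thetaFour_add_one,
          thetaTwo_add_one, e1]
        ring
      · simp only [Fin.reduceFinMk, Matrix.cons_val, thetaOne_add_one, thetaThree_add_one, e1]
        ring)
    (neg_ne_zero.2 (Complex.exp_ne_zero _))
    (by
      intro j z
      rw [hK]
      fin_cases j
      · simp only [Fin.zero_eta, Matrix.cons_val_zero, i1, i3, thetaOne_add_I,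
          thetaThree_add_I, eI]
        ring
      · simp only [Fin.mk_one, Matrix.cons_val_one, Matrix.cons_val_zero, thetaFour_add_I,
          thetaTwo_add_I, eI]
        ring
      · simp only [Fin.reduceFinMk, Matrix.cons_val, thetaOne_add_I, thetaThree_add_I, eI]
        ring)
  simp only [Matrix.cons_val_zero, Matrix.cons_val_one, Matrix.cons_val] at hrel
  have hrel' : ∀ z, c 0 * (deriv thetaOne z * thetaThree z - thetaOne z * deriv thetaThree z) +
      c 1 * (thetaFour z * thetaTwo z) + c 2 * (thetaOne z * thetaThree z) = 0 := fun z => by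
    have h : cexp (Real.pi * I * z) *
      (c 0 * (deriv thetaOne z * thetaThree z - thetaOne z * deriv thetaThree z) +
      c 1 * (thetaFour z * thetaTwo z) + c 2 * (thetaOne z * thetaThree z)) = 0 := by
      linear_combination hrel z
    exact (mul_eq_zero.1 h).resolve_left (Complex.exp_ne_zero _)
  have hm := thetaThree_half_ne_zero
  have hc2 : c 2 = 0 := by
    have h1 := hrel' (1 / 2)
    have h2 := hrel' (-(1 / 2))
    rw [n1, n3, t2, thetaOne_neg, thetaThree_neg] at h2
    have h : c 2 * (thetaThree (1 / 2) ^ 2) = 0 := by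
      have h3 := thetaOne_half
      rw [h3] at h1 h2
      linear_combination (h2 - h1) / 2
    exact (mul_eq_zero.1 h).resolve_right (pow_ne_zero 2 hm)
  have hc0 : c 0 ≠ 0 := fun h0 => by
    have h := hrel' 0
    rw [h0, hc2, thetaFour_zero, thetaTwo_zero] at h
    have h1 : c 1 = 0 := by
      simpa only [zero_mul, zero_add, add_zero, mul_eq_zero, hm, or_false] using h
    exact hc (by ext j; fin_cases j <;> simp [h0, h1, hc2])
  refine ⟨-(c 1 / c 0), fun z => ?_⟩
  have h := hrel' z
  rw [hc2] at h
  field_simp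
  linear_combination h

/-! ### Positivity of ϑ₂ on (-1/2, 1/2) -/

/-- Bounds the higher terms of the cosine series of ϑ₂ by a multiple of the first, uniformly up to
the zeros at ±1/2. The induction needs the companion bound for sin(2nt). -/
theorem abs_cos_odd_mul_le (n : ℕ) (t : ℝ) :
    |Real.cos ((2 * n + 1) * t)| ≤ (2 * n + 1) * |Real.cos t| := by
  have hs : ∀ n : ℕ, |Real.sin (2 * n * t)| ≤ 2 * n * |Real.cos t| ∧
      |Real.cos ((2 * n + 1) * t)| ≤ (2 * n + 1) * |Real.cos t| := by
    intro n
    induction n with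
    | zero => simp
    | succ n ih =>
      have h1 : |Real.sin (2 * (n + 1 : ℕ) * t)| ≤ 2 * (n + 1 : ℕ) * |Real.cos t| := by
        rw [show 2 * ((n + 1 : ℕ) : ℝ) * t = (2 * n + 1) * t + t by push_cast; ring, Real.sin_add]
        have e : (2 * (n : ℝ) + 1) * t = 2 * n * t + t := by ring
        have h2 := abs_add_le (Real.sin ((2 * n + 1) * t) * Real.cos t)
          (Real.cos ((2 * n + 1) * t) * Real.sin t)
        rw [abs_mul, abs_mul] at h2
        have h3 := mul_le_of_le_one_left (abs_nonneg (Real.cos t))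
          (Real.abs_sin_le_one ((2 * n + 1) * t))
        have h4 := mul_le_of_le_one_right (abs_nonneg (Real.cos ((2 * n + 1) * t)))
          (Real.abs_sin_le_one t)
        push_cast
        linarith [ih.2]
      refine ⟨h1, ?_⟩
      rw [show (2 * ((n + 1 : ℕ) : ℝ) + 1) * t = 2 * (n + 1 : ℕ) * t + t by ring, Real.cos_add]
      have h2 := abs_sub (Real.cos (2 * (n + 1 : ℕ) * t) * Real.cos t)
        (Real.sin (2 * (n + 1 : ℕ) * t) * Real.sin t)
      rw [abs_mul, abs_mul] at h2
      have h3 := mul_le_of_le_one_left (abs_nonneg (Real.cos t))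
        (Real.abs_cos_le_one (2 * (n + 1 : ℕ) * t))
      have h4 := mul_le_of_le_one_right (abs_nonneg (Real.sin (2 * (n + 1 : ℕ) * t)))
        (Real.abs_sin_le_one t)
      linarith
  exact (hs n).2

/-- Terms n and -(n + 1) of the theta series are paired. -/
theorem hasSum_thetaTwo_ofReal (x : ℝ) :
    HasSum (fun n : ℕ => ((2 * Real.exp (-(Real.pi * (n + 1 / 2) ^ 2)) *
      Real.cos ((2 * n + 1) * (Real.pi * x)) : ℝ) : ℂ)) (thetaTwo x) := by
  have h0 := ((hasSum_jacobiTheta₂_term (x + I / 2) (τ := I) (by simp)).mul_left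
    (cexp (-(Real.pi / 4) + Real.pi * I * x))).nat_add_neg_add_one
  refine h0.congr_fun fun n => ?_
  push_cast
  rw [Complex.cos, jacobiTheta₂_term, jacobiTheta₂_term, mul_div_assoc',
    div_eq_iff two_ne_zero, ← Complex.exp_add, ← Complex.exp_add]
  push_cast
  have a1 : -(Real.pi / 4 : ℂ) + Real.pi * I * x +
      (2 * Real.pi * I * n * (x + I / 2) + Real.pi * I * n ^ 2 * I) =
      -(Real.pi * (n + 1 / 2) ^ 2) + (2 * n + 1) * (Real.pi * x) * I := by
    linear_combination (Real.pi * n + Real.pi * n ^ 2 : ℂ) * I_sq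
  have a2 : -(Real.pi / 4 : ℂ) + Real.pi * I * x +
      (2 * Real.pi * I * (-(n + 1)) * (x + I / 2) + Real.pi * I * (-(n + 1)) ^ 2 * I) =
      -(Real.pi * (n + 1 / 2) ^ 2) + -((2 * n + 1) * (Real.pi * x)) * I := by
    linear_combination (-Real.pi * (n + 1) + Real.pi * (n + 1) ^ 2 : ℂ) * I_sq
  rw [a1, a2, Complex.exp_add, Complex.exp_add]
  ring

theorem thetaTwo_ofReal (x : ℝ) : thetaTwo x = (thetaTwo x).re := by
  refine Complex.ext (ofReal_re _).symm ?_
  rw [ofReal_im]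
  have h := hasSum_im (hasSum_thetaTwo_ofReal x)
  simp only [ofReal_im] at h
  exact h.unique hasSum_zero

theorem thetaTwo_ofReal_re_pos {x : ℝ} (hx : |x| < 1 / 2) : 0 < (thetaTwo x).re := by
  have h : HasSum (fun n : ℕ => 2 * Real.exp (-(Real.pi * (n + 1 / 2) ^ 2)) *
      Real.cos ((2 * n + 1) * (Real.pi * x))) (thetaTwo x).re := by
    simpa only [ofReal_re] using hasSum_re (hasSum_thetaTwo_ofReal x)
  set C := Real.cos (Real.pi * x) with hC
  have hCpos : 0 < C := by
    have := abs_lt.1 hx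
    apply Real.cos_pos_of_mem_Ioo
    constructor <;> nlinarith [Real.pi_pos]
  set B := 2 * Real.exp (-(Real.pi / 4)) * C with hB
  have hBpos : 0 < B := by positivity
  have hr : Real.exp (-(2 * Real.pi)) ≤ 1 / 12 := by
    rw [Real.exp_neg, ← one_div]
    refine one_div_le_one_div_of_le (by norm_num) ?_
    linarith [Real.add_one_le_exp (2 * Real.pi), Real.pi_gt_three,
      Real.quadratic_le_exp_of_nonneg (x := 6) (by norm_num),
      Real.exp_le_exp.2 (show (6 : ℝ) ≤ 2 * Real.pi by linarith [Real.pi_gt_three])]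
  -- The minorant is B at n = 0 and -B/4ⁿ afterwards, with sum 2B/3. The ratio 1/4 is 3 · 1/12: 3ⁿ
  -- bounds 2n + 1 and 12⁻ⁿ bounds the Gaussian decay.
  have hg : HasSum (fun n : ℕ => (if n = 0 then 2 * B else 0) - B * (1 / 4 : ℝ) ^ n)
      (2 * B - B * (1 - 1 / 4)⁻¹) := by
    refine (hasSum_ite_eq 0 (2 * B)).sub ((hasSum_geometric_of_lt_one ?_ ?_).mul_left B) <;> norm_num
  refine lt_of_lt_of_le ?_ (hasSum_le (fun n => ?_) hg h)
  · linarith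
  rcases Nat.eq_zero_or_pos n with rfl | hn
  · simp only [if_true, pow_zero, CharP.cast_eq_zero, mul_zero, zero_add, one_mul, hB, ← hC]
    rw [show Real.pi * (1 / 2) ^ 2 = Real.pi / 4 by ring]
    linarith
  · rw [if_neg hn.ne', zero_sub, neg_le]
    refine (neg_le_abs _).trans ?_
    rw [abs_mul, abs_of_pos (by positivity : (0 : ℝ) < 2 * Real.exp (-(Real.pi * (n + 1 / 2) ^ 2)))]
    have hn1 : (1 : ℝ) ≤ n := by exact_mod_cast hn
    have h1 : Real.exp (-(Real.pi * (n + 1 / 2) ^ 2)) ≤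
        Real.exp (-(Real.pi / 4)) * (1 / 12) ^ n := by
      calc Real.exp (-(Real.pi * (n + 1 / 2) ^ 2))
          ≤ Real.exp (-(Real.pi / 4) + n * -(2 * Real.pi)) := by
            apply Real.exp_le_exp.2
            nlinarith [Real.pi_pos, mul_nonneg Real.pi_pos.le
              (mul_nonneg (sub_nonneg.2 hn1) (by positivity : (0 : ℝ) ≤ n))]
        _ = Real.exp (-(Real.pi / 4)) * Real.exp (-(2 * Real.pi)) ^ n := by
            rw [Real.exp_add, Real.exp_nat_mul]
        _ ≤ _ := by gcongr
    have h2 := abs_cos_odd_mul_le n (Real.pi * x)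
    rw [← hC, abs_of_pos hCpos] at h2
    have h3 : (2 * n + 1 : ℝ) ≤ 3 ^ n := by
      have := one_add_mul_le_pow (show (-2 : ℝ) ≤ 2 by norm_num) n
      norm_num at this
      linarith
    calc 2 * Real.exp (-(Real.pi * (n + 1 / 2) ^ 2)) * |Real.cos ((2 * n + 1) * (Real.pi * x))|
        ≤ 2 * (Real.exp (-(Real.pi / 4)) * (1 / 12) ^ n) * (3 ^ n * C) := by
          gcongr
          exact h2.trans (by gcongr)
      _ = B * (1 / 4) ^ n := by
          rw [show (1 / 4 : ℝ) = 1 / 12 * 3 by norm_num, mul_pow]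
          ring

/-! ### The differential equation of the theta quotient and its constant -/

theorem setIntegral_rpow_mul_rpow_one_sub {a b : ℝ} (ha : 0 < a) (hb : 0 < b) :
    ∫ u in Set.Ioo (0 : ℝ) 1, u ^ (a - 1) * (1 - u) ^ (b - 1) =
      Real.Gamma a * Real.Gamma b / Real.Gamma (a + b) := by
  have h := betaIntegral_eq_Gamma_mul_div a b (by simpa) (by simpa)
  rw [← ofReal_add, Gamma_ofReal, Gamma_ofReal, Gamma_ofReal, betaIntegral,
    intervalIntegral.integral_of_le zero_le_one, MeasureTheory.integral_Ioc_eq_integral_Ioo] at h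
  have e : ∫ u in Set.Ioo (0 : ℝ) 1, (u : ℂ) ^ ((a : ℂ) - 1) * (1 - (u : ℂ)) ^ ((b : ℂ) - 1) =
      ∫ u in Set.Ioo (0 : ℝ) 1, ((u ^ (a - 1) * (1 - u) ^ (b - 1) : ℝ) : ℂ) := by
    refine MeasureTheory.setIntegral_congr_fun measurableSet_Ioo fun u hu => ?_
    rw [ofReal_mul, ofReal_cpow hu.1.le, ofReal_cpow (sub_nonneg.2 hu.2.le)]
    push_cast
    rfl
  rw [e, integral_complex_ofReal] at h
  exact_mod_cast h

theorem Real.Gamma_one_quarter_mul_Gamma_three_quarters :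
    Real.Gamma (1 / 4) * Real.Gamma (3 / 4) = √2 * Real.pi := by
  have h := Real.Gamma_mul_Gamma_one_sub (1 / 4)
  rw [show (1 : ℝ) - 1 / 4 = 3 / 4 by norm_num, show Real.pi * (1 / 4) = Real.pi / 4 by ring,
    Real.sin_pi_div_four] at h
  rw [h]
  have : √2 * √2 = (2 : ℝ) := Real.mul_self_sqrt zero_le_two
  field_simp
  linear_combination -this

theorem thetaQuot_eq (z : ℂ) : thetaQuot z = thetaOne z / thetaThree z := by
  rw [thetaQuot, thetaChar_half_half, thetaChar_zero_zero, thetaOne]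

theorem thetaQuot_zero : thetaQuot 0 = 0 := by rw [thetaQuot_eq, thetaOne_zero, zero_div]

theorem thetaQuot_half : thetaQuot (1 / 2) = -1 := by
  have h : thetaThree (1 / 2) ≠ 0 := thetaThree_half_ne_zero
  rw [thetaQuot_eq, thetaOne_half, neg_div, div_self h]

/-- The factors exp(πz²) of numerator and denominator cancel. -/
theorem thetaQuot_I_mul (z : ℂ) : thetaQuot (I * z) = I * thetaQuot z := by
  rw [thetaQuot_eq, thetaQuot_eq, thetaThree_I_mul, thetaOne, thetaTwo_I_mul_add_half, ← thetaOne,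
    mul_assoc, mul_div_assoc, mul_div_mul_left _ _ (Complex.exp_ne_zero _)]

theorem analyticAt_thetaQuot {z : ℂ} (hz : thetaThree z ≠ 0) : AnalyticAt ℂ thetaQuot z := by
  rw [funext thetaQuot_eq]
  exact (differentiable_thetaOne.analyticAt z).fun_div (differentiable_thetaThree.analyticAt z) hz

theorem ofReal_sqrt_two_sq : ((√2 : ℝ) : ℂ) ^ 2 = 2 := by
  rw [← ofReal_pow, Real.sq_sqrt zero_le_two]
  norm_num

/-- The product of the relations for ϑ₄² and ϑ₂². -/
theorem two_mul_sq_eq_one_sub_thetaQuot {z : ℂ} (hz : thetaThree z ≠ 0) :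
    2 * (thetaFour z * thetaTwo z / thetaThree z ^ 2) ^ 2 = 1 - thetaQuot z ^ 4 := by
  have h4 := sqrt_two_mul_thetaFour_sq z
  have h2 := sqrt_two_mul_thetaTwo_sq z
  rw [thetaQuot_eq]
  field_simp
  rw [← ofReal_sqrt_two_sq]
  linear_combination (√2 : ℝ) * thetaTwo z ^ 2 * h4 + (thetaThree z ^ 2 + thetaOne z ^ 2) * h2

theorem hasDerivAt_of_wronskian {c : ℂ} (hc : ∀ z,
    deriv thetaOne z * thetaThree z - thetaOne z * deriv thetaThree z =
      c * (thetaFour z * thetaTwo z)) {z : ℂ} (hz : thetaThree z ≠ 0) :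
    HasDerivAt thetaQuot (c * (thetaFour z * thetaTwo z / thetaThree z ^ 2)) z := by
  rw [funext thetaQuot_eq, ← mul_div_assoc, ← hc z]
  exact (differentiable_thetaOne z).hasDerivAt.fun_div (differentiable_thetaThree z).hasDerivAt hz

/-- A function on `[0, 1 / 2]` increasing from `0` to `1` with `p' = μ √(1 - p⁴)` has
`2 μ = B(1/4, 1/2)`. -/
theorem two_mul_eq_of_hasDerivAt_sqrt {p p' : ℝ → ℝ} {μ : ℝ} (hμ : 0 < μ)
    (hp : ∀ x ∈ Set.Icc (0 : ℝ) (1 / 2), HasDerivAt p (p' x) x) (hp0 : p 0 = 0)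
    (hp1 : p (1 / 2) = 1) (hpos : ∀ x ∈ Set.Ioo (0 : ℝ) (1 / 2), 0 < p' x)
    (hsq : ∀ x ∈ Set.Ioo (0 : ℝ) (1 / 2), p' x ^ 2 = μ ^ 2 * (1 - p x ^ 4)) :
    2 * μ = Real.Gamma (1 / 4) * Real.Gamma (1 / 2) / Real.Gamma (3 / 4) := by
  have hcont : ContinuousOn p (Set.Icc 0 (1 / 2)) :=
    fun x hx => (hp x hx).continuousAt.continuousWithinAt
  have hmono : StrictMonoOn p (Set.Icc 0 (1 / 2)) := by
    refine strictMonoOn_of_deriv_pos (convex_Icc _ _) hcont fun x hx => ?_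
    rw [interior_Icc] at hx
    rw [(hp x (Set.Ioo_subset_Icc_self hx)).deriv]
    exact hpos x hx
  have hmem0 : (0 : ℝ) ∈ Set.Icc (0 : ℝ) (1 / 2) := by norm_num
  have hmem1 : (1 / 2 : ℝ) ∈ Set.Icc (0 : ℝ) (1 / 2) := by norm_num
  have hrange : ∀ x ∈ Set.Ioo (0 : ℝ) (1 / 2), 0 < p x ∧ p x < 1 := fun x hx => by
    have h := Set.Ioo_subset_Icc_self hx
    exact ⟨hp0 ▸ hmono hmem0 h hx.1, hp1 ▸ hmono h hmem1 hx.2⟩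
  have himage : (fun x => p x ^ 4) '' Set.Ioo 0 (1 / 2) = Set.Ioo 0 1 := by
    apply Set.Subset.antisymm
    · rintro _ ⟨x, hx, rfl⟩
      obtain ⟨h0, h1⟩ := hrange x hx
      exact ⟨by positivity, pow_lt_one₀ h0.le h1 (by norm_num)⟩
    · have := intermediate_value_Ioo (by norm_num : (0 : ℝ) ≤ 1 / 2) (hcont.pow 4)
      simpa only [Pi.pow_apply, hp0, hp1, one_pow, zero_pow four_ne_zero] using this
  have hinj : Set.InjOn (fun x => p x ^ 4) (Set.Ioo 0 (1 / 2)) := by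
    intro x hx y hy hxy
    have h := (pow_left_inj₀ (hrange x hx).1.le (hrange y hy).1.le four_ne_zero).1 hxy
    exact hmono.injOn (Set.Ioo_subset_Icc_self hx) (Set.Ioo_subset_Icc_self hy) h
  -- The substitution u = p(x)⁴ turns the integrand of B(1/4, 1/2) into the constant 4μ on an
  -- interval of length 1/2.
  have hcv := MeasureTheory.integral_image_eq_integral_abs_deriv_smul
    (f' := fun x => 4 * p x ^ 3 * p' x) measurableSet_Ioo
    (fun x hx => by
      simpa using ((hp x (Set.Ioo_subset_Icc_self hx)).fun_pow 4).hasDerivWithinAt) hinj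
    (fun u : ℝ => u ^ ((1 / 4 : ℝ) - 1) * (1 - u) ^ ((1 / 2 : ℝ) - 1))
  rw [himage, setIntegral_rpow_mul_rpow_one_sub (by norm_num) (by norm_num)] at hcv
  have hconst : ∀ x ∈ Set.Ioo (0 : ℝ) (1 / 2), |4 * p x ^ 3 * p' x| •
      ((p x ^ 4) ^ ((1 / 4 : ℝ) - 1) * (1 - p x ^ 4) ^ ((1 / 2 : ℝ) - 1)) = 4 * μ := by
    intro x hx
    obtain ⟨h0, h1⟩ := hrange x hx
    have h2 : 0 < 1 - p x ^ 4 := sub_pos.2 (pow_lt_one₀ h0.le h1 (by norm_num))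
    have h3 : p' x = μ * √(1 - p x ^ 4) := by
      rw [← pow_left_inj₀ (hpos x hx).le (by positivity) two_ne_zero, mul_pow,
        Real.sq_sqrt h2.le, hsq x hx]
    have h4 : (p x ^ 4) ^ ((1 / 4 : ℝ) - 1) = (p x ^ 3)⁻¹ := by
      rw [← Real.rpow_natCast (p x) 4, ← Real.rpow_mul h0.le, ← Real.rpow_natCast (p x) 3,
        ← Real.rpow_neg h0.le]
      norm_num
    have h5 : (1 - p x ^ 4) ^ ((1 / 2 : ℝ) - 1) = (√(1 - p x ^ 4))⁻¹ := by
      rw [Real.sqrt_eq_rpow, ← Real.rpow_neg h2.le]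
      norm_num
    have h6 : √(1 - p x ^ 4) ≠ 0 := (Real.sqrt_pos.2 h2).ne'
    rw [abs_of_pos (mul_pos (by positivity) (hpos x hx)), h3, h4, h5, smul_eq_mul]
    field_simp
  rw [MeasureTheory.setIntegral_congr_fun measurableSet_Ioo hconst,
    MeasureTheory.setIntegral_const, MeasureTheory.measureReal_def, Real.volume_Ioo] at hcv
  norm_num at hcv
  rw [show (1 : ℝ) / 4 = 4⁻¹ by norm_num, show (1 : ℝ) / 2 = 2⁻¹ by norm_num]
  linarith

theorem thetaThree_ofReal (x : ℝ) : thetaThree x = (thetaThree x).re ∧ 0 < (thetaThree x).re := by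
  obtain ⟨r, hr, h⟩ := thetaThree_ofReal_pos x
  rw [h]
  simpa using hr

/-- The constant `Γ(1/4)² / (2 √(2 π))`. -/
noncomputable def lemniscateFactor : ℝ := Real.Gamma (1 / 4) ^ 2 / (2 * √(2 * Real.pi))

theorem lemniscateFactor_pos : 0 < lemniscateFactor := by
  have := Real.Gamma_pos_of_pos (show (0 : ℝ) < 1 / 4 by norm_num)
  unfold lemniscateFactor
  have := Real.pi_pos
  positivity

theorem hasDerivAt_thetaQuot {z : ℂ} (hz : thetaThree z ≠ 0) :
    HasDerivAt thetaQuot (-(lemniscateFactor * (√2 : ℝ)) *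
      (thetaFour z * thetaTwo z / thetaThree z ^ 2)) z := by
  obtain ⟨c, hc⟩ := exists_wronskian_eq
  have hd : ∀ x : ℝ, HasDerivAt thetaQuot _ x := fun x =>
    hasDerivAt_of_wronskian hc (thetaThree_ofReal_ne_zero x)
  set t : ℝ → ℝ := fun x => (thetaThree x).re with ht
  set r : ℝ → ℝ := fun x => (thetaTwo x).re with hr
  have htpos : ∀ x, 0 < t x := fun x => (thetaThree_ofReal x).2
  have hT : ∀ x : ℝ, thetaThree x = t x := fun x => (thetaThree_ofReal x).1
  have hR : ∀ x : ℝ, thetaTwo x = r x := thetaTwo_ofReal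
  have hM : ∀ x : ℝ, thetaFour x = t (x + 1 / 2) := fun x => by
    rw [← hT, thetaFour]
    push_cast
    rfl
  have hN : ∀ x : ℝ, thetaOne x = r (x + 1 / 2) := fun x => by
    rw [← hR, thetaOne]
    push_cast
    rfl
  set w : ℝ → ℝ := fun x => t (x + 1 / 2) * r x / t x ^ 2 with hw
  have hW : ∀ x : ℝ, thetaFour x * thetaTwo x / thetaThree x ^ 2 = w x := fun x => by
    rw [hM, hR, hT, hw]
    push_cast
    rfl
  set p : ℝ → ℝ := fun x => -(r (x + 1 / 2) / t x) with hp
  have hQ : ∀ x : ℝ, thetaQuot x = -p x := fun x => by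
    rw [thetaQuot_eq, hN, hT, hp]
    push_cast
    ring
  have hwpos : ∀ x ∈ Set.Ioo (0 : ℝ) (1 / 2), 0 < w x := fun x hx => by
    have h1 : 0 < r x := thetaTwo_ofReal_re_pos (abs_lt.2 ⟨by linarith [hx.1], hx.2⟩)
    have h2 := htpos x
    have h3 := htpos (x + 1 / 2)
    positivity
  have hp' : ∀ x : ℝ, HasDerivAt p (-c.re * w x) x := fun x => by
    have h := (hd x).real_of_complex.neg
    rw [hW, re_mul_ofReal, ← neg_mul] at h
    refine h.congr_of_eventuallyEq (Eventually.of_forall fun y => ?_)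
    simp [hQ]
  have hp0 : p 0 = 0 := by
    have := hQ 0
    rw [ofReal_zero, thetaQuot_zero] at this
    exact_mod_cast (neg_eq_zero.1 this.symm)
  have hp1 : p (1 / 2) = 1 := by
    have := hQ (1 / 2)
    rw [show ((1 / 2 : ℝ) : ℂ) = 1 / 2 by norm_num, thetaQuot_half] at this
    exact_mod_cast (neg_injective this).symm
  -- The mean value theorem, with p rising from 0 to 1, fixes the sign of `c.re`.
  obtain ⟨x, hx, hslope⟩ := exists_hasDerivAt_eq_slope p _ (by norm_num : (0 : ℝ) < 1 / 2)
    (fun x _ => (hp' x).continuousAt.continuousWithinAt) (fun x _ => hp' x)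
  rw [hp0, hp1] at hslope
  have hcre : 0 < -c.re := by
    have h := hwpos x hx
    refine pos_of_mul_pos_left ?_ h.le
    rw [hslope]
    norm_num
  have hcreal : c = c.re := by
    have h1 := (hd x).comp_ofReal
    have h2 := (hp' x).neg.ofReal_comp
    have h3 := h1.unique (h2.congr_of_eventuallyEq (Eventually.of_forall fun y => by
      simp [hQ]))
    rw [hW] at h3
    have h4 : (w x : ℂ) ≠ 0 := by exact_mod_cast (hwpos x hx).ne'
    apply mul_right_cancel₀ h4
    rw [h3]
    push_cast
    ring
  have hs2 : (√2 : ℝ) ^ 2 = 2 := Real.sq_sqrt zero_le_two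
  have hs0 : 0 < √2 := by positivity
  have hfin := two_mul_eq_of_hasDerivAt_sqrt (μ := -c.re / √2) (by positivity)
    (fun x _ => hp' x) hp0 hp1 (fun x hx => mul_pos hcre (hwpos x hx)) (fun x hx => by
      have h := two_mul_sq_eq_one_sub_thetaQuot (thetaThree_ofReal_ne_zero x)
      rw [hW, hQ] at h
      have h' : 2 * w x ^ 2 = 1 - (-p x) ^ 4 := by exact_mod_cast h
      rw [div_pow, hs2]
      linear_combination c.re ^ 2 / 2 * h')
  have hcval : c.re = -(lemniscateFactor * √2) := by
    have hG := Real.Gamma_one_quarter_mul_Gamma_three_quarters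
    have hG4 := Real.Gamma_pos_of_pos (show (0 : ℝ) < 1 / 4 by norm_num)
    have hG34 := Real.Gamma_pos_of_pos (show (0 : ℝ) < 3 / 4 by norm_num)
    rw [Real.Gamma_one_half_eq, eq_div_iff hG34.ne'] at hfin
    have hspi : √Real.pi ^ 2 = Real.pi := Real.sq_sqrt Real.pi_pos.le
    have hspi0 : 0 < √Real.pi := Real.sqrt_pos.2 Real.pi_pos
    have key : -c.re * (2 * √Real.pi) = Real.Gamma (1 / 4) ^ 2 := by
      have h : -c.re * 2 * Real.Gamma (3 / 4) = √2 * (Real.Gamma (1 / 4) * √Real.pi) := by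
        rw [← hfin]
        field_simp
      apply mul_right_cancel₀ (mul_pos hG34 hspi0).ne'
      linear_combination √Real.pi ^ 2 * h + √2 * Real.Gamma (1 / 4) * √Real.pi * hspi -
        Real.Gamma (1 / 4) * √Real.pi * hG
    rw [lemniscateFactor, ← key, Real.sqrt_mul zero_le_two]
    field_simp
  rw [← ofReal_mul, ← ofReal_neg, ← hcval, ← hcreal]
  exact hasDerivAt_of_wronskian hc hz

/-! ### The lemniscate integral as a hypergeometric function -/

/-- The analytic function `G w = w F(1/4, 1/2, 5/4; w ^ 4) = ∫_0^w (1 - t ^ 4) ^ (-1/2) dt`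
on the unit disc. -/
noncomputable def arcsinLemniscate (w : ℂ) : ℂ :=
  w * ordinaryHypergeometric (1 / 4 : ℂ) (1 / 2) (5 / 4) (w ^ 4)

theorem one_sub_mem_slitPlane {y : ℂ} (hy : ‖y‖ < 1) : 1 - y ∈ slitPlane := by
  rw [sub_eq_add_neg]
  exact mem_slitPlane_of_norm_lt_one (by rwa [norm_neg])

theorem hasSum_one_sub_cpow_neg {a y : ℂ} (hy : ‖y‖ < 1) :
    HasSum (fun n : ℕ => ((n.factorial : ℂ)⁻¹ * (ascPochhammer ℂ n).eval a) * y ^ n)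
      ((1 - y) ^ (-a)) := by
  have h := (one_add_cpow_hasFPowerSeriesOnBall_zero (a := -a)).hasSum (y := -y) (by
    rw [← ENNReal.ofReal_one, Metric.eball_ofReal]
    simpa using hy)
  -- The binomial series is F(a, b; b; ·) for any admissible b; b = 1 serves here.
  rw [zero_add, ← sub_eq_add_neg, binomialSeries_eq_ordinaryHypergeometricSeries (b := (1 : ℂ))
    (by intro k; norm_cast), neg_neg] at h
  refine h.congr_fun fun n => ?_
  rw [FormalMultilinearSeries.compContinuousLinearMap_apply]
  have e : (⇑(-(ContinuousLinearMap.id ℂ ℂ)) ∘ fun _ : Fin n => -y) = fun _ => y := by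
    ext
    simp
  rw [e, ordinaryHypergeometricSeries_apply_eq, smul_eq_mul, mul_assoc _ _ (_⁻¹),
    mul_inv_cancel₀, mul_one]
  rw [ascPochhammer_eval_one]
  exact_mod_cast n.factorial_ne_zero

theorem ascPochhammer_eval_add_one_eq (a : ℂ) (n : ℕ) :
    a * (ascPochhammer ℂ n).eval (a + 1) = (a + n) * (ascPochhammer ℂ n).eval a := by
  induction n with
  | zero => simp
  | succ n ih =>
    rw [ascPochhammer_succ_eval, ascPochhammer_succ_eval]
    push_cast
    linear_combination (a + 1 + n) * ih

/-- The quotient telescopes; its value is ∫_0^1 s^(4n) ds. -/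
theorem ascPochhammer_eval_div_eval_add_one (n : ℕ) :
    (ascPochhammer ℂ n).eval (1 / 4 : ℂ) * ((ascPochhammer ℂ n).eval (5 / 4 : ℂ))⁻¹ =
      (4 * n + 1 : ℂ)⁻¹ := by
  have h := ascPochhammer_eval_add_one_eq (1 / 4) n
  rw [show (1 / 4 : ℂ) + 1 = 5 / 4 by norm_num] at h
  have h0 : (ascPochhammer ℂ n).eval (5 / 4 : ℂ) ≠ 0 := by
    rw [Ne, ascPochhammer_eval_eq_zero_iff]
    rintro ⟨k, -, hk⟩
    have h5 : ((4 * k : ℕ) : ℤ) = ((-5 : ℤ)) := by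
      have : ((4 * k : ℕ) : ℂ) = ((-5 : ℤ) : ℂ) := by
        push_cast
        rw [hk]
        ring
      exact_mod_cast this
    omega
  have h1 : (4 * n + 1 : ℂ) ≠ 0 := by exact_mod_cast Nat.succ_ne_zero (4 * n)
  field_simp
  linear_combination -4 * h

theorem norm_pow_four_lt_one {w : ℂ} (hw : ‖w‖ < 1) : ‖w ^ 4‖ < 1 := by
  rw [norm_pow]
  exact pow_lt_one₀ (norm_nonneg _) hw (by norm_num)

/-- Termwise integration of the binomial series, dominated by its terms at s = 1. -/
theorem arcsinLemniscate_eq_integral {w : ℂ} (hw : ‖w‖ < 1) :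
    arcsinLemniscate w = ∫ s in (0 : ℝ)..1, w * (1 - (s * w) ^ 4) ^ (-(1 / 2) : ℂ) := by
  set b : ℕ → ℂ := fun n => (n.factorial : ℂ)⁻¹ * (ascPochhammer ℂ n).eval (1 / 2 : ℂ) with hb
  have hnorm : Summable fun n => ‖w * (b n * (w ^ 4) ^ n)‖ :=
    ((hasSum_one_sub_cpow_neg (norm_pow_four_lt_one hw)).mul_left w).summable.norm
  have h : HasSum (fun n : ℕ => ∫ s in (0 : ℝ)..1, w * (b n * ((s * w) ^ 4) ^ n))
      (∫ s in (0 : ℝ)..1, w * (1 - (s * w) ^ 4) ^ (-(1 / 2) : ℂ)) := by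
    refine intervalIntegral.hasSum_integral_of_dominated_convergence
      (fun n _ => ‖w * (b n * (w ^ 4) ^ n)‖) (fun n => ?_) (fun n => ?_) ?_ ?_ ?_
    · exact Continuous.aestronglyMeasurable (by fun_prop)
    · refine Eventually.of_forall fun s hs => ?_
      rw [Set.uIoc_of_le zero_le_one] at hs
      simp only [norm_mul, norm_pow, norm_real, Real.norm_eq_abs, abs_of_pos hs.1]
      have h0 := hs.1.le
      gcongr
      exact mul_le_of_le_one_left (norm_nonneg w) hs.2
    · exact Eventually.of_forall fun _ _ => hnorm
    · exact intervalIntegrable_const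
    · refine Eventually.of_forall fun s hs => ?_
      rw [Set.uIoc_of_le zero_le_one] at hs
      refine (hasSum_one_sub_cpow_neg (norm_pow_four_lt_one ?_)).mul_left w
      rw [norm_mul, norm_real, Real.norm_eq_abs, abs_of_pos hs.1]
      exact (mul_le_of_le_one_left (norm_nonneg _) hs.2).trans_lt hw
  have hterm : ∀ n : ℕ, ∫ s in (0 : ℝ)..1, w * (b n * ((s * w) ^ 4) ^ n) =
      w * (((n.factorial : ℂ)⁻¹ * (ascPochhammer ℂ n).eval (1 / 4 : ℂ) *
        (ascPochhammer ℂ n).eval (1 / 2 : ℂ) * ((ascPochhammer ℂ n).eval (5 / 4 : ℂ))⁻¹) •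
        (w ^ 4) ^ n) := by
    intro n
    have e : ∀ s : ℝ, w * (b n * ((s * w) ^ 4) ^ n) =
        w * (b n * (w ^ 4) ^ n) * ((s ^ (4 * n) : ℝ) : ℂ) := fun s => by
      push_cast
      ring
    simp only [e]
    rw [intervalIntegral.integral_const_mul, intervalIntegral.integral_ofReal, integral_pow,
      smul_eq_mul]
    have h5 := ascPochhammer_eval_div_eval_add_one n
    simp only [one_pow, ne_eq, Nat.add_eq_zero_iff, one_ne_zero, and_false, not_false_eq_true,
      zero_pow, sub_zero]
    push_cast
    rw [one_div, ← h5]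
    ring
  simp only [hterm] at h
  rw [arcsinLemniscate, ordinaryHypergeometric_eq_tsum, ← tsum_mul_left]
  exact h.tsum_eq

theorem differentiableAt_one_sub_pow_four_cpow {w : ℂ} (hw : ‖w‖ < 1) (a : ℂ) :
    DifferentiableAt ℂ (fun w : ℂ => (1 - w ^ 4) ^ a) w := by
  have h : DifferentiableAt ℂ (fun w : ℂ => 1 - w ^ 4) w := by fun_prop
  exact h.cpow_const (one_sub_mem_slitPlane (norm_pow_four_lt_one hw))

/-- The integrand has a primitive on the disc, and the radial integral recovers the one vanishing at
0. -/
theorem hasDerivAt_arcsinLemniscate {w : ℂ} (hw : ‖w‖ < 1) :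
    HasDerivAt arcsinLemniscate ((1 - w ^ 4) ^ (-(1 / 2) : ℂ)) w := by
  have hd : DifferentiableOn ℂ (fun w : ℂ => (1 - w ^ 4) ^ (-(1 / 2) : ℂ)) (Metric.ball 0 1) :=
    fun w hw => (differentiableAt_one_sub_pow_four_cpow (by simpa using hw) _).differentiableWithinAt
  obtain ⟨P, hP0, hP⟩ := hd.isExactOn_ball.with_val_at 0 0
  have heq : ∀ v ∈ Metric.ball (0 : ℂ) 1, arcsinLemniscate v = P v := by
    intro v hv
    have hv' : ‖v‖ < 1 := by simpa using hv
    have hmem : ∀ s ∈ Set.uIcc (0 : ℝ) 1, ‖(s : ℂ) * v‖ < 1 := fun s hs => by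
      rw [Set.uIcc_of_le zero_le_one] at hs
      rw [norm_mul, norm_real, Real.norm_eq_abs, abs_of_nonneg hs.1]
      exact (mul_le_of_le_one_left (norm_nonneg _) hs.2).trans_lt hv'
    rw [arcsinLemniscate_eq_integral hv']
    have h := intervalIntegral.integral_eq_sub_of_hasDerivAt (a := 0) (b := 1)
      (f := fun s : ℝ => P (s * v)) (f' := fun s : ℝ => v * (1 - (s * v) ^ 4) ^ (-(1 / 2) : ℂ))
      (fun s hs => by
        have h1 := hP (s * v) (by simpa using hmem s hs)
        have h2 : HasDerivAt (fun s : ℝ => (s : ℂ) * v) v s := by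
          simpa using (hasDerivAt_id (s : ℂ)).comp_ofReal.mul_const v
        have := h1.comp s h2
        rwa [mul_comm] at this)
      (ContinuousOn.intervalIntegrable fun s hs => by
        refine ContinuousAt.continuousWithinAt (continuousAt_const.mul ?_)
        exact ContinuousAt.comp (g := fun w : ℂ => (1 - w ^ 4) ^ (-(1 / 2) : ℂ))
          (differentiableAt_one_sub_pow_four_cpow (hmem s hs) _).continuousAt (by fun_prop))
    rw [h]
    simp [hP0]
  have hmem : w ∈ Metric.ball (0 : ℂ) 1 := by simpa using hw
  exact (hP w hmem).congr_of_eventuallyEq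
    (eventually_of_mem (Metric.isOpen_ball.mem_nhds hmem) heq)

/-- The antiderivative in r is 4 G(r^(1/4) w). Euler's integral takes this form when w⁴ = 1 - x. -/
theorem integral_one_sub_mul_cpow {w : ℂ} (hw : ‖w‖ < 1) :
    ∫ r in (0 : ℝ)..1, w * (1 - r * w ^ 4) ^ (-(1 / 2) : ℂ) * (r : ℂ) ^ (-(3 / 4) : ℂ) =
      4 * arcsinLemniscate w := by
  have hmem : ∀ r ∈ Set.Icc (0 : ℝ) 1, ‖((r ^ (1 / 4 : ℝ) : ℝ) : ℂ) * w‖ < 1 := fun r hr => by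
    rw [norm_mul, norm_real, Real.norm_eq_abs, abs_of_nonneg (Real.rpow_nonneg hr.1 _)]
    exact (mul_le_of_le_one_left (norm_nonneg _)
      (Real.rpow_le_one hr.1 hr.2 (by norm_num))).trans_lt hw
  have h := intervalIntegral.integral_eq_sub_of_hasDerivAt_of_le (a := 0) (b := 1) zero_le_one
    (f := fun r : ℝ => 4 * arcsinLemniscate (((r ^ (1 / 4 : ℝ) : ℝ) : ℂ) * w))
    (f' := fun r : ℝ => w * (1 - r * w ^ 4) ^ (-(1 / 2) : ℂ) * (r : ℂ) ^ (-(3 / 4) : ℂ))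
    (fun r hr => by
      refine ContinuousAt.continuousWithinAt (continuousAt_const.mul ?_)
      refine ContinuousAt.comp (g := arcsinLemniscate)
        (hasDerivAt_arcsinLemniscate (hmem r hr)).continuousAt ?_
      refine ContinuousAt.mul ?_ continuousAt_const
      exact continuous_ofReal.continuousAt.comp
        (Real.continuousAt_rpow_const _ _ (Or.inr (by norm_num))))
    (fun r hr => by
      have h1 := hasDerivAt_arcsinLemniscate (hmem r (Set.Ioo_subset_Icc_self hr))
      have h2 := ((Real.hasDerivAt_rpow_const (p := 1 / 4) (Or.inl hr.1.ne')).ofReal_comp.mul_const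
        w)
      have h3 := (h1.comp r h2).const_mul 4
      refine h3.congr_deriv ?_
      have e1 : (((r ^ (1 / 4 : ℝ) : ℝ) : ℂ) * w) ^ 4 = r * w ^ 4 := by
        rw [mul_pow, ← ofReal_pow, ← Real.rpow_natCast, ← Real.rpow_mul hr.1.le]
        norm_num
      have e2 : ((r ^ ((1 / 4 : ℝ) - 1) : ℝ) : ℂ) = (r : ℂ) ^ (-(3 / 4) : ℂ) := by
        rw [ofReal_cpow hr.1.le]
        norm_num
      rw [e1, ofReal_mul, e2]
      push_cast
      ring)
    (by
      refine IntervalIntegrable.continuousOn_mul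
        (intervalIntegral.intervalIntegrable_cpow' (by norm_num)) fun r hr => ?_
      rw [Set.uIcc_of_le zero_le_one] at hr
      refine ContinuousAt.continuousWithinAt (continuousAt_const.mul ?_)
      refine ContinuousAt.cpow (by fun_prop) continuousAt_const (one_sub_mem_slitPlane ?_)
      rw [norm_mul, norm_real, Real.norm_eq_abs, abs_of_nonneg hr.1]
      exact (mul_le_of_le_one_left (norm_nonneg _) hr.2).trans_lt (norm_pow_four_lt_one hw))
  rw [h]
  simp [arcsinLemniscate]

/-! ### Inversion near the origin and on the unit disc -/

theorem hasDerivAt_thetaQuot_zero : HasDerivAt thetaQuot (-(lemniscateFactor : ℂ)) 0 := by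
  refine (hasDerivAt_thetaQuot thetaThree_zero_ne_zero).congr_deriv ?_
  have h := thetaThree_half_ne_zero
  have h2 : (√2 : ℝ) ≠ (0 : ℂ) := fun h => by
    have := ofReal_sqrt_two_sq
    rw [h] at this
    norm_num at this
  rw [thetaFour_zero, thetaTwo_zero, sqrt_two_mul_thetaFour_sq_and.1]
  field_simp

theorem eventually_thetaThree_ne_zero : ∀ᶠ z in 𝓝 (0 : ℂ), thetaThree z ≠ 0 :=
  differentiable_thetaThree.continuous.continuousAt.eventually_ne thetaThree_zero_ne_zero

theorem eventually_norm_thetaQuot_lt_one : ∀ᶠ z in 𝓝 (0 : ℂ), ‖thetaQuot z‖ < 1 := by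
  have h := hasDerivAt_thetaQuot_zero.continuousAt.norm
  rw [ContinuousAt, thetaQuot_zero, norm_zero] at h
  exact h.eventually_lt_const one_pos

/-- The inversion of the lemniscate integral by theta functions near the origin. -/
theorem eventually_arcsinLemniscate_thetaQuot :
    ∀ᶠ z in 𝓝 (0 : ℂ), arcsinLemniscate (thetaQuot z) = -lemniscateFactor * z := by
  -- D is a square root of 1 - q⁴ with D(0) = 1. Near 0 its real part is positive, so it is the
  -- principal root and G'(q) q' = D⁻¹ · (-λ D) = -λ.
  set D : ℂ → ℂ := fun z => (√2 : ℝ) * (thetaFour z * thetaTwo z / thetaThree z ^ 2) with hD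
  have hl : (lemniscateFactor : ℂ) ≠ 0 := by exact_mod_cast lemniscateFactor_pos.ne'
  have hD0 : D 0 = 1 := by
    have h := (hasDerivAt_thetaQuot thetaThree_zero_ne_zero).unique hasDerivAt_thetaQuot_zero
    apply mul_left_cancel₀ (neg_ne_zero.2 hl)
    simp only [hD]
    linear_combination h
  have hDc : ContinuousAt D 0 := by
    have h2 := differentiable_thetaTwo.continuous
    have h3 := differentiable_thetaThree.continuous
    have h4 := differentiable_thetaFour.continuous
    refine continuousAt_const.mul (ContinuousAt.div (by fun_prop) (by fun_prop) ?_)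
    exact pow_ne_zero 2 thetaThree_zero_ne_zero
  have hDre : ∀ᶠ z in 𝓝 (0 : ℂ), 0 < (D z).re := by
    have h := continuous_re.continuousAt.comp hDc
    refine h.eventually (lt_mem_nhds ?_)
    simp [hD0]
  have hder : ∀ᶠ z in 𝓝 (0 : ℂ),
      HasDerivAt (fun z => arcsinLemniscate (thetaQuot z) + lemniscateFactor * z) 0 z := by
    filter_upwards [hDre, eventually_thetaThree_ne_zero, eventually_norm_thetaQuot_lt_one] with
      z h1 h2 h3
    have h4 := (hasDerivAt_arcsinLemniscate h3).comp z (hasDerivAt_thetaQuot h2)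
    refine (h4.add ((hasDerivAt_id z).const_mul (lemniscateFactor : ℂ))).congr_deriv ?_
    have h5 : 1 - thetaQuot z ^ 4 = D z ^ 2 := by
      rw [← two_mul_sq_eq_one_sub_thetaQuot h2, hD, mul_pow, ofReal_sqrt_two_sq]
    have h6 : D z ≠ 0 := fun h => by simp [h] at h1
    rw [h5, cpow_neg, one_div, sq_cpow_two_inv h1]
    have h7 : (D z)⁻¹ * D z = 1 := inv_mul_cancel₀ h6
    rw [hD] at h7 ⊢
    linear_combination (-lemniscateFactor : ℂ) * h7
  obtain ⟨ε, hε, hball⟩ := Metric.eventually_nhds_iff_ball.1 hder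
  obtain ⟨a, ha⟩ := Metric.isOpen_ball.exists_is_const_of_deriv_eq_zero
    (convex_ball (0 : ℂ) ε).isPreconnected
    (fun z hz => (hball z hz).differentiableAt.differentiableWithinAt)
    (fun z hz => (hball z hz).deriv)
  have ha0 := ha 0 (Metric.mem_ball_self hε)
  rw [thetaQuot_zero, arcsinLemniscate, zero_mul, mul_zero, add_zero] at ha0
  filter_upwards [Metric.ball_mem_nhds (0 : ℂ) hε] with z hz
  have := ha z hz
  rw [← ha0] at this
  linear_combination this

/-- The inverse of the lemniscate integral on the whole unit disc. -/
theorem thetaQuot_arcsinLemniscate {w : ℂ} (hw : ‖w‖ < 1) :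
    thetaThree (-(lemniscateFactor : ℂ)⁻¹ * arcsinLemniscate w) ≠ 0 ∧
      thetaQuot (-(lemniscateFactor : ℂ)⁻¹ * arcsinLemniscate w) = w := by
  have hl : (lemniscateFactor : ℂ) ≠ 0 := by exact_mod_cast lemniscateFactor_pos.ne'
  set φ : ℂ → ℂ := fun w => -(lemniscateFactor : ℂ)⁻¹ * arcsinLemniscate w with hφ
  have hmap : map thetaQuot (𝓝 0) = 𝓝 0 := by
    have h := (analyticAt_thetaQuot thetaThree_zero_ne_zero).hasStrictDerivAt.map_nhds_eq (by
      rw [hasDerivAt_thetaQuot_zero.deriv]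
      exact neg_ne_zero.2 hl)
    rwa [thetaQuot_zero] at h
  -- Without division both sides are holomorphic on the whole disc, so the identity theorem applies
  -- before ϑ₃(φ w) is known to be nonzero.
  have hloc : ∀ᶠ w in 𝓝 (0 : ℂ), thetaOne (φ w) = w * thetaThree (φ w) := by
    rw [← hmap, eventually_map]
    filter_upwards [eventually_arcsinLemniscate_thetaQuot, eventually_thetaThree_ne_zero] with
      z h1 h2
    have h3 : φ (thetaQuot z) = z := by
      rw [hφ]
      simp only [h1]
      field_simp
    rw [h3, thetaQuot_eq, div_mul_cancel₀ _ h2]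
  have hφd : DifferentiableOn ℂ φ (Metric.ball 0 1) := fun w hw =>
    ((hasDerivAt_arcsinLemniscate (by simpa using hw)).differentiableAt.const_mul
      _).differentiableWithinAt
  have hg : DifferentiableOn ℂ (fun w => w * thetaThree (φ w)) (Metric.ball 0 1) :=
    differentiableOn_id.mul (differentiable_thetaThree.comp_differentiableOn hφd)
  have hf : DifferentiableOn ℂ (fun w => thetaOne (φ w)) (Metric.ball 0 1) :=
    differentiable_thetaOne.comp_differentiableOn hφd
  have heq := (hf.analyticOnNhd Metric.isOpen_ball).eqOn_of_preconnected_of_eventuallyEq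
    (hg.analyticOnNhd Metric.isOpen_ball) (convex_ball (0 : ℂ) 1).isPreconnected
    (Metric.mem_ball_self one_pos) hloc (show w ∈ Metric.ball 0 1 by simpa using hw)
  simp only at heq
  have hne : thetaThree (φ w) ≠ 0 := fun h => by
    refine thetaOne_thetaThree_no_common_zero ?_ h
    rw [heq, h, mul_zero]
  exact ⟨hne, by rw [thetaQuot_eq, heq, mul_div_cancel_right₀ _ hne]⟩

/-! ### The Schwarz map -/

theorem ofReal_mul_cpow {r : ℝ} (hr : 0 < r) {y : ℂ} (hy : y ≠ 0) (a : ℂ) :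
    ((r : ℂ) * y) ^ a = (r : ℂ) ^ a * y ^ a := by
  have hr' : (r : ℂ) ≠ 0 := by exact_mod_cast hr.ne'
  rw [cpow_def_of_ne_zero (mul_ne_zero hr' hy), cpow_def_of_ne_zero hr', cpow_def_of_ne_zero hy,
    log_ofReal_mul hr hy, ofReal_log hr.le, add_mul, Complex.exp_add]

theorem cpow_one_quarter_pow_four (y : ℂ) : (y ^ (1 / 4 : ℂ)) ^ 4 = y := by
  rw [← cpow_nat_mul]
  norm_num

theorem norm_cpow_one_quarter_lt_one {y : ℂ} (hy : ‖y‖ < 1) : ‖y ^ (1 / 4 : ℂ)‖ < 1 := by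
  rw [← cpow_one_quarter_pow_four y, norm_pow] at hy
  exact lt_of_pow_lt_pow_left₀ 4 zero_le_one (by simpa using hy)

theorem eulerSol₁_eq {x : ℂ} (hx : ‖1 - x‖ < 1) (hx1 : 1 - x ≠ 0) :
    eulerSol₁ (1 / 4) 0 (1 / 2) x =
      4 * ((1 + I) / (√2 : ℝ)) * arcsinLemniscate ((1 - x) ^ (1 / 4 : ℂ)) := by
  obtain ⟨y, rfl⟩ : ∃ y, x = 1 - y := ⟨1 - x, by ring⟩
  rw [sub_sub_cancel] at hx hx1 ⊢
  set w := y ^ (1 / 4 : ℂ) with hw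
  have hw4 : w ^ 4 = y := cpow_one_quarter_pow_four y
  have hwn : ‖w‖ < 1 := norm_cpow_one_quarter_lt_one hx
  -- This is exp(-3πi/4), from the prescribed argument of t - 1; its minus sign cancels that of the
  -- factor x - 1 = -y.
  have hE : cexp (Real.pi * I * (1 / 2 - 1 / 4 - 1)) = -((1 + I) / (√2 : ℝ)) := by
    rw [show Real.pi * I * (1 / 2 - 1 / 4 - 1) = (Real.pi / 4 : ℝ) * I - Real.pi * I by
      push_cast; ring, Complex.exp_sub, exp_pi_mul_I, exp_mul_I, ← ofReal_cos, ← ofReal_sin,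
      Real.cos_pi_div_four, Real.sin_pi_div_four]
    have h2 := ofReal_sqrt_two_sq
    have h0 : ((√2 : ℝ) : ℂ) ≠ 0 := fun h => by
      rw [h] at h2
      norm_num at h2
    push_cast
    field_simp
    linear_combination -(1 + I) * h2
  have hyw : y ^ (-(3 / 4) : ℂ) * y = w := by
    nth_rewrite 2 [← cpow_one y]
    rw [← cpow_add _ _ hx1, hw]
    norm_num
  have hint : eulerSol₁ (1 / 4) 0 (1 / 2) (1 - y) = ∫ r in (0 : ℝ)..1, ((1 + I) / (√2 : ℝ)) *
      (w * (1 - r * w ^ 4) ^ (-(1 / 2) : ℂ) * (r : ℂ) ^ (-(3 / 4) : ℂ)) := by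
    refine intervalIntegral.integral_congr_Ioo_of_le zero_le_one fun r hr => ?_
    simp only [sub_sub_cancel]
    rw [hE, neg_zero, cpow_zero, show (1 : ℂ) / 2 - 1 / 4 - 1 = -(3 / 4) by norm_num,
      ofReal_mul_cpow hr.1 hx1, hw4, ← hyw, zero_sub,
      show 1 + (r : ℂ) * (1 - y - 1) = 1 - r * y by ring]
    ring
  rw [hint, intervalIntegral.integral_const_mul, integral_one_sub_mul_cpow hwn]
  ring

/-- Since β = 0 the variable x drops out, and t = 1/u gives B(1/4, 1/4). -/
theorem eulerSol₂_eq (x : ℂ) : eulerSol₂ (1 / 4) 0 (1 / 2) x =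
    ((Real.Gamma (1 / 4) ^ 2 / √Real.pi : ℝ) : ℂ) := by
  have himage : (fun u : ℝ => u⁻¹) '' Set.Ioo 0 1 = Set.Ioi 1 := by
    ext t
    constructor
    · rintro ⟨u, hu, rfl⟩
      exact (one_lt_inv₀ hu.1).2 hu.2
    · intro ht
      have ht0 : (0 : ℝ) < t := one_pos.trans ht
      exact ⟨t⁻¹, ⟨inv_pos.2 ht0, inv_lt_one_of_one_lt₀ ht⟩, inv_inv t⟩
  have hcv := MeasureTheory.integral_image_eq_integral_abs_deriv_smul
    (s := Set.Ioo (0 : ℝ) 1) measurableSet_Ioo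
    (fun u hu => (hasDerivAt_inv hu.1.ne').hasDerivWithinAt) inv_injective.injOn
    (fun t : ℝ => t ^ (-(1 / 2) : ℝ) * (t - 1) ^ (-(3 / 4) : ℝ))
  have hbeta := setIntegral_rpow_mul_rpow_one_sub (a := 1 / 4) (b := 1 / 4) (by norm_num)
    (by norm_num)
  rw [show (1 : ℝ) / 4 + 1 / 4 = 1 / 2 by norm_num, Real.Gamma_one_half_eq, ← sq] at hbeta
  have hcongr : ∀ u ∈ Set.Ioo (0 : ℝ) 1, |-(u ^ 2)⁻¹| •
      (u⁻¹ ^ (-(1 / 2) : ℝ) * (u⁻¹ - 1) ^ (-(3 / 4) : ℝ)) =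
      u ^ ((1 / 4 : ℝ) - 1) * (1 - u) ^ ((1 / 4 : ℝ) - 1) := by
    intro u hu
    have h0 := hu.1
    have h1 : u⁻¹ - 1 = (1 - u) / u := by field_simp
    rw [abs_neg, abs_of_pos (by positivity), smul_eq_mul, h1,
      Real.div_rpow (sub_nonneg.2 hu.2.le) h0.le, Real.inv_rpow h0.le, ← Real.rpow_neg h0.le,
      div_eq_mul_inv _ (u ^ (-(3 / 4) : ℝ)), ← Real.rpow_neg h0.le, ← Real.rpow_natCast u 2, ← Real.rpow_neg h0.le,
      show (1 / 4 : ℝ) - 1 = -(3 / 4) by norm_num]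
    have h2 : u ^ (-(3 / 4) : ℝ) =
        u ^ (-((2 : ℕ) : ℝ)) * u ^ (-(-(1 / 2)) : ℝ) * u ^ (-(-(3 / 4)) : ℝ) := by
      rw [← Real.rpow_add h0, ← Real.rpow_add h0]
      norm_num
    rw [h2]
    ring
  rw [himage, MeasureTheory.setIntegral_congr_fun measurableSet_Ioo hcongr, hbeta] at hcv
  rw [← hcv, ← integral_complex_ofReal]
  refine MeasureTheory.setIntegral_congr_fun measurableSet_Ioi fun t ht => ?_
  have ht' : (1 : ℝ) < t := ht
  rw [neg_zero, cpow_zero, mul_one, ofReal_mul, ofReal_cpow (by linarith),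
    ofReal_cpow (by linarith)]
  push_cast
  norm_num

/-- The Schwarz map as a lemniscate integral. -/
theorem schwarzMap_eq {x : ℂ} (hx : ‖1 - x‖ < 1) (hx1 : 1 - x ≠ 0) :
    schwarzMap x =
      I * ((lemniscateFactor : ℂ)⁻¹ * arcsinLemniscate ((1 - x) ^ (1 / 4 : ℂ))) := by
  rw [schwarzMap, eulerSol₁_eq hx hx1, eulerSol₂_eq, lemniscateFactor,
    Real.sqrt_mul zero_le_two]
  have hG := Real.Gamma_pos_of_pos (show (0 : ℝ) < 1 / 4 by norm_num)
  have hG' : (Real.Gamma (1 / 4) : ℂ) ≠ 0 := by exact_mod_cast hG.ne'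
  have hp : (√Real.pi : ℂ) ≠ 0 := by exact_mod_cast (Real.sqrt_pos.2 Real.pi_pos).ne'
  have h2 := ofReal_sqrt_two_sq
  have h0 : ((√2 : ℝ) : ℂ) ≠ 0 := by exact_mod_cast (Real.sqrt_pos.2 two_pos).ne'
  have hI : (1 : ℂ) - I ≠ 0 := fun h => by
    have := congrArg re h
    simp at this
  push_cast
  rw [div_eq_iff (by positivity)]
  field_simp
  rw [h2]
  -- What remains is (1 + i) = i (1 - i).
  linear_combination 4 * arcsinLemniscate ((1 - x) ^ (1 / 4 : ℂ)) * I_sq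

theorem one_sub_mem_of_mem_lensU {x : ℂ} (hx : x ∈ lensU) : ‖1 - x‖ < 1 ∧ 1 - x ≠ 0 := by
  refine ⟨(max_lt_iff.1 hx.1).2, fun h => ?_⟩
  have := congrArg im h
  simp [hx.2.ne'] at this

theorem exists_eq_I_pow_mul {w q : ℂ} (h : w ^ 4 = q ^ 4) : ∃ j : ℕ, w = I ^ j * q := by
  have hI := I_sq
  have hf : (w - q) * (w + q) * ((w - I * q) * (w + I * q)) = 0 := by
    linear_combination h - (w ^ 2 * q ^ 2 - q ^ 4) * hI
  rcases mul_eq_zero.1 hf with h | h <;> rcases mul_eq_zero.1 h with h | h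
  · exact ⟨0, by linear_combination h⟩
  · exact ⟨2, by linear_combination h - q * hI⟩
  · exact ⟨1, by linear_combination h⟩
  · exact ⟨3, by linear_combination h - I * q * hI⟩

theorem mainTheorem11 :
    -- the identity for `z` around `0`; its left-hand side is well defined there
    (∀ᶠ z in 𝓝 (0 : ℂ),
      thetaChar 0 0 z I ≠ 0 ∧ ‖thetaQuot z ^ 4‖ < 1 ∧
      -((2 * √(2 * Real.pi) / Real.Gamma (1 / 4) ^ 2 : ℝ) : ℂ) * thetaQuot z *
        ordinaryHypergeometric (1 / 4 : ℂ) (1 / 2) (5 / 4) (thetaQuot z ^ 4) = z) ∧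
    -- `z ↦ 1 - ϑ_{1/2,1/2}(z, i)⁴ / ϑ_{0,0}(z, i)⁴` inverts the Schwarz map on its domain
    (∀ x ∈ lensU, thetaChar 0 0 (schwarzMap x) I ≠ 0 ∧ 1 - thetaQuot (schwarzMap x) ^ 4 = x) ∧
    -- conversely, the Schwarz map inverts it near `0`, up to the action of `{1, i, -1, -i}`
    (∀ᶠ z in 𝓝 (0 : ℂ), 1 - thetaQuot z ^ 4 ∈ lensU →
      ∃ k : ℕ, schwarzMap (1 - thetaQuot z ^ 4) = I ^ k * z) := by
  have hl : (lemniscateFactor : ℂ) ≠ 0 := by exact_mod_cast lemniscateFactor_pos.ne'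
  have hC : ((2 * √(2 * Real.pi) / Real.Gamma (1 / 4) ^ 2 : ℝ) : ℂ) =
      (lemniscateFactor : ℂ)⁻¹ := by
    rw [← ofReal_inv, lemniscateFactor, inv_div]
  refine ⟨?_, fun x hx => ?_, ?_⟩
  · filter_upwards [eventually_arcsinLemniscate_thetaQuot, eventually_thetaThree_ne_zero,
      eventually_norm_thetaQuot_lt_one] with z h1 h2 h3
    refine ⟨by rwa [thetaChar_zero_zero], norm_pow_four_lt_one h3, ?_⟩
    rw [arcsinLemniscate] at h1
    rw [hC, mul_assoc, h1]
    field_simp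
  · obtain ⟨hx1, hx0⟩ := one_sub_mem_of_mem_lensU hx
    set w := (1 - x) ^ (1 / 4 : ℂ) with hw
    have hw4 : w ^ 4 = 1 - x := cpow_one_quarter_pow_four _
    have hwn : ‖w‖ < 1 := norm_cpow_one_quarter_lt_one hx1
    obtain ⟨h1, h2⟩ := thetaQuot_arcsinLemniscate hwn
    -- Since i = i³ · (-1), three applications of q(iz) = i q(z) give q(S(x)) = i³ w.
    have hS : schwarzMap x =
        I * (I * (I * (-(lemniscateFactor : ℂ)⁻¹ * arcsinLemniscate w))) := by
      rw [schwarzMap_eq hx1 hx0]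
      linear_combination ((lemniscateFactor : ℂ)⁻¹ * arcsinLemniscate w) * I * I_sq
    rw [hS, thetaChar_zero_zero, thetaQuot_I_mul, thetaQuot_I_mul, thetaQuot_I_mul, h2]
    refine ⟨?_, ?_⟩
    · simp only [thetaThree_I_mul]
      exact mul_ne_zero (Complex.exp_ne_zero _) (mul_ne_zero (Complex.exp_ne_zero _)
        (mul_ne_zero (Complex.exp_ne_zero _) h1))
    · simp only [mul_pow, I_pow_four, one_mul, hw4]
      ring
  · filter_upwards [eventually_arcsinLemniscate_thetaQuot] with z h1 hz
    obtain ⟨hx1, hx0⟩ := one_sub_mem_of_mem_lensU hz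
    rw [schwarzMap_eq hx1 hx0, sub_sub_cancel]
    obtain ⟨j, hj⟩ := exists_eq_I_pow_mul (cpow_one_quarter_pow_four (thetaQuot z ^ 4))
    -- The principal root is iʲ q and G(iʲ q) = iʲ G(q) = -iʲ λ z; the prefactor i λ⁻¹ leaves -i ·
    -- iʲ z, and -i = i³.
    refine ⟨j + 3, ?_⟩
    have h2 : arcsinLemniscate ((thetaQuot z ^ 4) ^ (1 / 4 : ℂ)) =
        I ^ j * (-lemniscateFactor * z) := by
      rw [← h1, arcsinLemniscate, cpow_one_quarter_pow_four, hj, arcsinLemniscate]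
      ring
    rw [h2, pow_add, I_pow_three]
    field_simp
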